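/- Let $L$ be a nonempty compact metric space of diameter at most $1$ which is an absolute Lipschitz neighborhood euclidean extensor (ALNER), i.e. for some $n$ there is a bi-Lipschitz embedding $e\colon L\to\mathbb R^n$, an open set $U\supseteq e(L)$ and a Lipschitz map $r\colon U\to L$ with $r(e(x))=x$ for all $x\in L$. Let $X$ be a proper metric space (all closed balls are compact). The open cone $\mathcal O L=(L\times[0,\infty))/(L\times\{0\})$ carries the metric $$d([x_1,t_1],[x_2,t_2])=|t_1-t_2|+\min\{t_1,t_2\}\,d(x_1,x_2).$$ A map $f$ between metric spaces is asymptotically Lipschitz if there are $\lambda,\varepsilon>0$ with $d(f(x),f(x'))\le\lambda d(x,x')+\varepsilon$ for all $x,x'$, and proper if it is continuous and preimages of compact sets are compact. A function $\varphi\colon X\to\mathbb R$ is slowly oscillating if for all $r,\varepsilon>0$ there is a compact $K\subset X$ such that $|\varphi(y)-\varphi(x)|<\varepsilon$ whenever $x\in X\setminus K$ and $d(x,y)<r$. The Higson compactification $\bar X$ is the compactification of $X$ corresponding to the family of all continuous bounded slowly oscillating functions (the closure of the image of $X$ under the diagonal map of this family), and $\nu X=\bar X\setminus X$ is the Higson corona.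 Then the following conditions are equivalent: 1. $\operatorname{aed}X\le[\mathcal O L]$, i.e. every proper asymptotically Lipschitz map from a closed subset of $X$ to $\mathcal O L$ extends to a proper asymptotically Lipschitz map $X\to\mathcal O L$; 2. $\operatorname{ed}\nu X\le[L]$, i.e. every continuous map from a closed subset of $\nu X$ to $L$ extends to a continuous map $\nu X\to L$. -/

import Mathlib

open Set Metric Topology
open scoped NNReal BoundedContinuousFunction

/-! ### The asymptotic category -/

/-- `f` is `(lam, ε)`-Lipschitz for some constants `lam, ε > 0`. -/
def AsympLipschitz {X Y : Type*} [MetricSpace X] [MetricSpace Y] (f : X → Y) : Prop :=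
  ∃ lam > (0 : ℝ), ∃ ε > (0 : ℝ), ∀ x x' : X, dist (f x) (f x') ≤ lam * dist x x' + ε

/-- Morphisms of the asymptotic category: proper asymptotically Lipschitz maps. (Continuity is
automatic for an asymptotically Lipschitz map into a proper metric space under which preimages
of compact sets are compact; it is listed only for convenience.) -/
structure IsAsympMorphism {X Y : Type*} [MetricSpace X] [MetricSpace Y] (f : X → Y) : Prop where
  continuous : Continuous f
  isCompact_preimage : ∀ K : Set Y, IsCompact K → IsCompact (f ⁻¹' K)
  asympLipschitz : AsympLipschitz f

/-- The Kuratowski relation `X τ P` in the asymptotic category: every proper asymptotically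
Lipschitz map from a closed subset of `X` to `P` has a proper asymptotically Lipschitz extension
to `X`. -/
def AsympTau (X P : Type*) [MetricSpace X] [MetricSpace P] : Prop :=
  ∀ A : Set X, IsClosed A → ∀ f : A → P, IsAsympMorphism f →
    ∃ g : X → P, IsAsympMorphism g ∧ ∀ a : A, g a = f a

/-! ### The open cone -/

/-- The equivalence relation on `L × [0, ∞)` that collapses `L × {0}` to a point. -/
def coneSetoid (L : Type*) : Setoid (L × ℝ≥0) where
  r p q := p = q ∨ (p.2 = 0 ∧ q.2 = 0)
  iseqv :=
    { refl := fun _ => Or.inl rfl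
      symm := by
        rintro p q (h | h)
        · exact Or.inl h.symm
        · exact Or.inr h.symm
      trans := by
        rintro p q r (rfl | h) (rfl | h')
        · exact Or.inl rfl
        · exact Or.inr h'
        · exact Or.inr h
        · exact Or.inr ⟨h.1, h'.2⟩ }

/-- The open cone `(L × [0, ∞)) / (L × {0})` of a metric space `L` of diameter at most `1`. -/
def OpenCone (L : Type*) [MetricSpace L] (_h : ∀ x y : L, dist x y ≤ 1) : Type _ :=
  Quotient (coneSetoid L)

/-- The cone distance, on representatives. -/
noncomputable def coneDist {L : Type*} [MetricSpace L] (p q : L × ℝ≥0) : ℝ :=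
  |(p.2 : ℝ) - q.2| + min (p.2 : ℝ) q.2 * dist p.1 q.1

theorem coneDist_comm {L : Type*} [MetricSpace L] (p q : L × ℝ≥0) :
    coneDist p q = coneDist q p := by
  simp only [coneDist, abs_sub_comm (p.2 : ℝ), min_comm (p.2 : ℝ), dist_comm p.1]

theorem coneDist_congr_right {L : Type*} [MetricSpace L] (p : L × ℝ≥0) {q q' : L × ℝ≥0}
    (h : (coneSetoid L).r q q') : coneDist p q = coneDist p q' := by
  rcases h with rfl | ⟨h, h'⟩
  · rfl
  · simp [coneDist, h, h']

theorem coneDist_triangle {L : Type*} [MetricSpace L] (hd : ∀ x y : L, dist x y ≤ 1)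
    (p q r : L × ℝ≥0) : coneDist p r ≤ coneDist p q + coneDist q r := by
  obtain ⟨x, a⟩ := p
  obtain ⟨y, b⟩ := q
  obtain ⟨z, c⟩ := r
  simp only [coneDist]
  have ha : (0 : ℝ) ≤ a := a.2
  have hb : (0 : ℝ) ≤ b := b.2
  have hc : (0 : ℝ) ≤ c := c.2
  have hxz := hd x z
  have h1 : (0 : ℝ) ≤ dist x y := dist_nonneg
  have h2 : (0 : ℝ) ≤ dist y z := dist_nonneg
  have h3 := dist_triangle x y z
  generalize (a : ℝ) = a at *
  generalize (b : ℝ) = b at *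
  generalize (c : ℝ) = c at *
  rcases le_total (min a c) b with hm | hm
  · have e1 : min a c ≤ min a b := le_min (min_le_left _ _) hm
    have e2 : min a c ≤ min b c := le_min hm (min_le_right _ _)
    have e0 : 0 ≤ min a c := le_min ha hc
    have := abs_sub_le a b c
    nlinarith [mul_le_mul_of_nonneg_left h3 e0, mul_le_mul_of_nonneg_right e1 h1,
      mul_le_mul_of_nonneg_right e2 h2]
  · have hba : b ≤ a := hm.trans (min_le_left _ _)
    have hbc : b ≤ c := hm.trans (min_le_right _ _)
    rw [min_eq_right hba, min_eq_left hbc, abs_of_nonneg (sub_nonneg.2 hba),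
      abs_of_nonpos (sub_nonpos.2 hbc)]
    have e3 : |a - c| = a + c - 2 * min a c := by
      rcases le_total a c with h | h
      · rw [min_eq_left h, abs_of_nonpos (sub_nonpos.2 h)]; ring
      · rw [min_eq_right h, abs_of_nonneg (sub_nonneg.2 h)]; ring
    rw [e3]
    nlinarith [mul_le_mul_of_nonneg_left h3 hb,
      mul_le_mul_of_nonneg_left hxz (sub_nonneg.2 hm)]

theorem coneDist_eq_zero {L : Type*} [MetricSpace L] {p q : L × ℝ≥0} (h : coneDist p q = 0) :
    (coneSetoid L).r p q := by
  obtain ⟨x, a⟩ := p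
  obtain ⟨y, b⟩ := q
  simp only [coneDist] at h
  have h1 : 0 ≤ |(a : ℝ) - b| := abs_nonneg _
  have h2 : 0 ≤ min (a : ℝ) b * dist x y :=
    mul_nonneg (le_min a.2 b.2) dist_nonneg
  have hab : a = b := by
    have : |(a : ℝ) - b| = 0 := by linarith
    exact NNReal.coe_injective (sub_eq_zero.1 (abs_eq_zero.1 this))
  subst hab
  have h3 : (a : ℝ) * dist x y = 0 := by simpa using h
  rcases mul_eq_zero.1 h3 with h4 | h4
  · exact Or.inr ⟨NNReal.coe_injective h4, NNReal.coe_injective h4⟩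
  · exact Or.inl (by rw [dist_eq_zero.1 h4])

/-- The cone metric
`d([x₁, t₁], [x₂, t₂]) = |t₁ - t₂| + min {t₁, t₂} * d(x₁, x₂)`. -/
noncomputable instance OpenCone.instMetricSpace (L : Type*) [MetricSpace L]
    (h : ∀ x y : L, dist x y ≤ 1) : MetricSpace (OpenCone L h) where
  dist := Quotient.lift₂ coneDist (fun p q p' q' hp hq => by
    rw [coneDist_congr_right p hq, coneDist_comm p q', coneDist_congr_right q' hp,
      coneDist_comm q' p'])
  dist_self := by
    rintro ⟨p⟩
    change coneDist p p = 0
    simp [coneDist]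
  dist_comm := by
    rintro ⟨p⟩ ⟨q⟩
    exact coneDist_comm p q
  dist_triangle := by
    rintro ⟨p⟩ ⟨q⟩ ⟨r⟩
    exact coneDist_triangle h p q r
  eq_of_dist_eq_zero := by
    rintro ⟨p⟩ ⟨q⟩ hpq
    exact Quotient.sound (coneDist_eq_zero hpq)

/-! ### The Higson compactification and corona -/

/-- `φ` is slowly oscillating: for every `r > 0` the oscillation
`sup {|φ y - φ x| : d(x, y) < r}` tends to `0` as `x` leaves all compact subsets of `X`. -/
def SlowlyOscillating {X : Type*} [MetricSpace X] (φ : X → ℝ) : Prop :=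
  ∀ r > (0 : ℝ), ∀ ε > (0 : ℝ), ∃ K : Set X, IsCompact K ∧
    ∀ x ∉ K, ∀ y ∈ ball x r, |φ y - φ x| < ε

/-- The family of all continuous bounded slowly oscillating functions on `X`. -/
def HigsonFunction (X : Type*) [MetricSpace X] : Type _ :=
  {φ : X →ᵇ ℝ // SlowlyOscillating φ}

/-- The diagonal map of the family of all continuous bounded slowly oscillating functions. -/
def higsonMap (X : Type*) [MetricSpace X] : X → (HigsonFunction X → ℝ) :=
  fun x φ => φ.1 x

/-- The Higson compactification of a proper metric space `X`: the compactification that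
corresponds to the family of continuous bounded slowly oscillating functions, i.e. the closure of
the image of the diagonal map in the product of copies of `ℝ`. -/
def higsonCompactification (X : Type*) [MetricSpace X] : Set (HigsonFunction X → ℝ) :=
  closure (range (higsonMap X))

/-- The Higson corona: the remainder of the Higson compactification, with the subspace
topology. -/
def higsonCorona (X : Type*) [MetricSpace X] : Set (HigsonFunction X → ℝ) :=
  higsonCompactification X \ range (higsonMap X)

/-! ### Extension dimension and Lipschitz extensors -/

/-- `ed Z ≤ [L]`, i.e. `Z τ L` in the topological category: every continuous map from a closed
subset of `Z` to `L` extends continuously to `Z`. -/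
def ExtDimLE (Z L : Type*) [TopologicalSpace Z] [TopologicalSpace L] : Prop :=
  ∀ C : Set Z, IsClosed C → ∀ f : C → L, Continuous f →
    ∃ g : Z → L, Continuous g ∧ ∀ c : C, g c = f c

/-- Absolute Lipschitz neighborhood euclidean extensors (for compact `L`): up to a bi-Lipschitz
embedding, `L` is a subset of some `ℝⁿ` and there is a Lipschitz retraction of a neighborhood of
`L` in `ℝⁿ` onto `L`. For compact `L` this amounts to: `L` embeds bi-Lipschitzly into some `ℝⁿ`,
and every Lipschitz map from a closed subset of a euclidean space to `L` has a Lipschitz extension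
to a neighborhood of that subset. -/
def IsALNER (L : Type*) [MetricSpace L] : Prop :=
  ∃ (n : ℕ) (e : L → EuclideanSpace ℝ (Fin n)),
    (∃ K : ℝ≥0, LipschitzWith K e) ∧ (∃ K : ℝ≥0, AntilipschitzWith K e) ∧
    ∃ U : Set (EuclideanSpace ℝ (Fin n)), IsOpen U ∧ range e ⊆ U ∧
      ∃ r : EuclideanSpace ℝ (Fin n) → L,
        (∃ K : ℝ≥0, LipschitzOnWith K r U) ∧ ∀ x : L, r (e x) = x

/-!
The cone over `L` is a Lipschitz retract of `ℝ × ℝⁿ` (`TubularRetraction.exists_cone_retraction`):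
the retraction of a tube around `e(L)` onto `L` is made conical, and the radius is cut off to zero
outside a conical neighborhood of the embedded cone. Real-valued continuous asymptotically Lipschitz
functions extend from closed subsets (McShane's infimum, corrected by Tietze's theorem), so
continuous asymptotically Lipschitz maps into the cone extend too
(`TubularRetraction.exists_extension_openCone`). Only properness of the extension is at stake, and
the corona decides about it.

The dictionary between the cone and the corona has two directions. The direction `x` of a proper
asymptotically Lipschitz map `[x, t]` is slowly oscillating, because its euclidean coordinates are
divided by a radius that tends to infinity; so it extends to the Higson compactification
(`TubularRetraction.exists_higson_direction`). Conversely, a slowly oscillating map, for instance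
the restriction to `X` of a continuous map on the Higson compactification, becomes the direction of
an asymptotically Lipschitz map into the cone once the radius grows slowly enough
(`SlowOsc.exists_slow`).

If proper maps into the cone extend, a map from a closed subset `C` of the corona to `L` extends,
by Tietze's theorem and the retraction, to a neighborhood of `C`. Its trace on `X` is a slowly
oscillating map on a closed set, which becomes a proper map into the cone. The direction of an
extension of that map, read on the corona, is the desired extension.

If maps into `L` extend over the corona, let `f : A → 𝒪L` be proper and `G` an extension of `f`
that need not be proper. On the region `N` in which the radius of `G` exceeds a slowly growing
function, the direction of `G` has limits on the corona. These extend to the whole corona, and hence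
to a slowly oscillating direction defined near infinity of `X` that agrees with the direction of `G`
on `N`. Its radius is taken to be that of `G` well inside `N`, in particular on `A` near infinity,
and to grow slowly elsewhere. Passing to the region `N`, which surrounds `A` at
infinity, is what makes the two prescriptions compatible; an extension of the direction from `A`
alone could oscillate too fast next to `A`. A bounded piece of `X` remains, over which the extension
without properness is used once more (`TubularRetraction.exists_extension_of_cobounded`).
-/

open Filter Bornology

/-! ### Asymptotically Lipschitz maps -/

theorem AsympLipschitz.of_le {X Y : Type*} [MetricSpace X] [MetricSpace Y] {f : X → Y}
    {lam ε : ℝ} (h : ∀ x x' : X, dist (f x) (f x') ≤ lam * dist x x' + ε) :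
    AsympLipschitz f :=
  ⟨max lam 1, lt_max_of_lt_right one_pos, max ε 1, lt_max_of_lt_right one_pos, fun x x' =>
    (h x x').trans (add_le_add
      (mul_le_mul_of_nonneg_right (le_max_left _ _) dist_nonneg) (le_max_left _ _))⟩

theorem LipschitzWith.asympLipschitz {X Y : Type*} [MetricSpace X] [MetricSpace Y] {f : X → Y}
    {K : ℝ≥0} (h : LipschitzWith K f) : AsympLipschitz f :=
  .of_le (lam := K) (ε := 0) fun x x' => by simpa using h.dist_le_mul x x'

theorem LipschitzWith.comp_asympLipschitz {X Y Z : Type*} [MetricSpace X] [MetricSpace Y]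
    [MetricSpace Z] {g : Y → Z} {f : X → Y} {K : ℝ≥0} (hg : LipschitzWith K g)
    (hf : AsympLipschitz f) : AsympLipschitz (g ∘ f) := by
  obtain ⟨lam, -, ε, -, h⟩ := hf
  refine .of_le (lam := K * lam) (ε := K * ε) fun x x' => ?_
  calc dist (g (f x)) (g (f x')) ≤ K * dist (f x) (f x') := hg.dist_le_mul _ _
    _ ≤ K * (lam * dist x x' + ε) := mul_le_mul_of_nonneg_left (h x x') K.2
    _ = _ := by ring

theorem AsympLipschitz.prodMk {X Y Z : Type*} [MetricSpace X] [MetricSpace Y]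
    [MetricSpace Z] {f : X → Y} {g : X → Z} (hf : AsympLipschitz f) (hg : AsympLipschitz g) :
    AsympLipschitz fun x => (f x, g x) := by
  obtain ⟨a, ha, b, hb, h⟩ := hf
  obtain ⟨c, hc, d, hd, h'⟩ := hg
  refine .of_le (lam := a + c) (ε := b + d) fun x x' => max_le ?_ ?_
  · have := h x x'
    have := mul_nonneg hc.le (dist_nonneg (x := x) (y := x'))
    simp only
    linarith
  · have := h' x x'
    have := mul_nonneg ha.le (dist_nonneg (x := x) (y := x'))
    simp only
    linarith

/-- Gluing over a bounded piece: if `F` is asymptotically Lipschitz on `Z` and maps the bounded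
set `B` to a bounded set, then it is asymptotically Lipschitz on `B ∪ Z`. -/
theorem exists_asympLipschitz_bound_union {X Y : Type*} [MetricSpace X] [MetricSpace Y] {F : X → Y}
    {B Z : Set X} {lam ε : ℝ} (hZ : ∀ x ∈ Z, ∀ y ∈ Z, dist (F x) (F y) ≤ lam * dist x y + ε)
    (hB : IsBounded B) (hFB : IsBounded (F '' B)) :
    ∃ lam' ε' : ℝ, ∀ x ∈ B ∪ Z, ∀ y ∈ B ∪ Z, dist (F x) (F y) ≤ lam' * dist x y + ε' := by
  rcases Z.eq_empty_or_nonempty with rfl | ⟨z, hz⟩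
  · obtain ⟨D, hD⟩ := isBounded_iff.1 hFB
    refine ⟨0, D, fun x hx y hy => ?_⟩
    rw [union_empty] at hx hy
    simpa using hD (mem_image_of_mem F hx) (mem_image_of_mem F hy)
  obtain ⟨R, hR⟩ := hB.subset_closedBall z
  obtain ⟨D, hD⟩ := hFB.subset_closedBall (F z)
  -- a common bound for the distance to the base point `z` and to its image
  have key : ∀ x ∈ B, ∀ y ∈ Z, dist (F x) (F y) ≤ |lam| * dist x y + (|lam| * |R| + |ε| + |D|) := by
    intro x hx y hy
    have h1 : dist (F x) (F z) ≤ D := hD (mem_image_of_mem F hx)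
    have h2 : dist x z ≤ R := hR hx
    have h3 := hZ z hz y hy
    have h4 : dist z y ≤ dist x y + |R| := by
      linarith [dist_triangle z x y, dist_comm z x, le_abs_self R]
    have h5 : lam * dist z y ≤ |lam| * (dist x y + |R|) :=
      (mul_le_mul_of_nonneg_right (le_abs_self _) dist_nonneg).trans
        (mul_le_mul_of_nonneg_left h4 (abs_nonneg _))
    linarith [dist_triangle (F x) (F z) (F y), le_abs_self D, le_abs_self ε]
  refine ⟨|lam|, |lam| * |R| + |ε| + 2 * |D|, ?_⟩
  have hR0 : 0 ≤ |lam| * |R| := by positivity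
  rintro x (hx | hx) y (hy | hy)
  · have h1 : dist (F x) (F z) ≤ D := hD (mem_image_of_mem F hx)
    have h2 : dist (F y) (F z) ≤ D := hD (mem_image_of_mem F hy)
    have : 0 ≤ |lam| * dist x y := by positivity
    linarith [dist_triangle_right (F x) (F y) (F z), le_abs_self D, abs_nonneg ε]
  · linarith [key x hx y hy, abs_nonneg D]
  · have := key y hy x hx
    rw [dist_comm (F x), dist_comm x]
    linarith [abs_nonneg D]
  · have : lam * dist x y ≤ |lam| * dist x y :=
      mul_le_mul_of_nonneg_right (le_abs_self _) dist_nonneg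
    linarith [hZ x hx y hy, le_abs_self ε, abs_nonneg D]

/-- The McShane infimum of an asymptotically Lipschitz function is Lipschitz and differs from
the function by a bounded continuous amount, which Tietze's theorem extends. -/
theorem AsympLipschitz.exists_extension_real {X : Type*} [MetricSpace X] {S : Set X}
    (hS : IsClosed S) {f : S → ℝ} (hf : Continuous f) (hfl : AsympLipschitz f) :
    ∃ g : X → ℝ, Continuous g ∧ AsympLipschitz g ∧ ∀ s : S, g s = f s := by
  rcases isEmpty_or_nonempty S with hE | hN
  · exact ⟨fun _ => 0, continuous_const, .of_le (lam := 0) (ε := 0) (by simp), hE.elim⟩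
  obtain ⟨lam, hlam, ε, hε, h⟩ := hfl
  have h' : ∀ a b : S, f a ≤ f b + lam * dist a b + ε := fun a b => by
    have := (le_abs_self _).trans (h a b)
    linarith
  set t : X → ℝ := fun x => ⨅ a : S, f a + lam * dist x a
  have hbdd : ∀ x : X, BddBelow (range fun a : S => f a + lam * dist x a) := by
    intro x
    obtain ⟨b⟩ := hN
    refine ⟨f b - lam * dist x b - ε, ?_⟩
    rintro _ ⟨a, rfl⟩
    have h1 := h' b a
    have h2 : dist b a ≤ dist x b + dist x a := dist_triangle_left (b : X) a x
    have := mul_le_mul_of_nonneg_left h2 hlam.le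
    simp only
    linarith
  have htle : ∀ x y, t x ≤ t y + lam * dist x y := by
    intro x y
    rw [← sub_le_iff_le_add]
    refine le_ciInf fun a => ?_
    rw [sub_le_iff_le_add]
    refine (ciInf_le (hbdd x) a).trans ?_
    have := mul_le_mul_of_nonneg_left (dist_triangle x y a) hlam.le
    linarith
  have htl : LipschitzWith lam.toNNReal t := by
    refine LipschitzWith.of_le_add_mul _ fun x y => ?_
    simpa [Real.coe_toNNReal _ hlam.le] using htle x y
  have hd : ∀ s : S, f s - t s ∈ Icc 0 ε := by
    intro s
    constructor
    · have := ciInf_le (hbdd s) s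
      simp only [dist_self, mul_zero, add_zero] at this
      exact sub_nonneg.2 this
    · rw [sub_le_comm]
      refine le_ciInf fun a => ?_
      have := h' s a
      rw [Subtype.dist_eq] at this
      linarith
  have hcont : Continuous fun s : S => f s - t s :=
    hf.sub (htl.continuous.comp continuous_subtype_val)
  let d : S →ᵇ ℝ := BoundedContinuousFunction.mkOfBound ⟨_, hcont⟩ ε fun x y => by
    have := Real.dist_le_of_mem_Icc (hd x) (hd y)
    simpa using this
  obtain ⟨D, hDmem, hD⟩ := d.exists_extension_forall_mem_Icc_of_isClosedEmbedding
    (fun x => hd x) hε.le hS.isClosedEmbedding_subtypeVal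
  refine ⟨fun x => t x + D x, htl.continuous.add D.continuous, ?_, fun s => ?_⟩
  · refine .of_le (lam := lam) (ε := ε) fun x y => ?_
    have h1 := htl.dist_le_mul x y
    rw [Real.coe_toNNReal _ hlam.le] at h1
    have h2 := Real.dist_le_of_mem_Icc (hDmem x) (hDmem y)
    linarith [dist_add_add_le (t x) (D x) (t y) (D y)]
  · have : D s = f s - t s := congrFun hD s
    simp [this]

theorem AsympLipschitz.exists_extension_euclideanSpace {X : Type*} [MetricSpace X] {S : Set X}
    (hS : IsClosed S) {n : ℕ} {f : S → EuclideanSpace ℝ (Fin n)} (hf : Continuous f)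
    (hfl : AsympLipschitz f) :
    ∃ g : X → EuclideanSpace ℝ (Fin n), Continuous g ∧ AsympLipschitz g ∧ ∀ s : S, g s = f s := by
  obtain ⟨lam, hlam, ε, hε, h⟩ := hfl
  have hcoord : ∀ i, ∃ g : X → ℝ, Continuous g ∧ AsympLipschitz g ∧ ∀ s : S, g s = f s i := by
    refine fun i => AsympLipschitz.exists_extension_real hS (f := fun s => f s i)
      (by fun_prop) ⟨lam, hlam, ε, hε, fun x y => ?_⟩
    refine le_trans ?_ (h x y)
    simpa [dist_eq_norm] using PiLp.norm_apply_le (f x - f y) i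
  choose g hgc hgl hg using hcoord
  choose a ha b hb hab using hgl
  refine ⟨fun x => WithLp.toLp 2 fun i => g i x, by fun_prop, ?_, fun s => ?_⟩
  · refine .of_le (lam := ∑ i, a i) (ε := ∑ i, b i) fun x y => ?_
    rw [EuclideanSpace.dist_eq, Finset.sum_mul, ← Finset.sum_add_distrib]
    refine (Real.sqrt_le_left (Finset.sum_nonneg fun i _ => ?_)).2 ?_
    · exact dist_nonneg.trans (hab i x y)
    · refine (Finset.sum_le_sum fun i _ => pow_le_pow_left₀ dist_nonneg (hab i x y) 2).trans ?_
      exact Finset.sum_sq_le_sq_sum_of_nonneg fun i _ => dist_nonneg.trans (hab i x y)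
  · ext i
    simp [hg]

/-! ### Slowly oscillating maps -/

/-- The pairs of points at distance less than `r`, the first of which tends to infinity. -/
def closePairsAtInfinity (X : Type*) [MetricSpace X] (r : ℝ) : Filter (X × X) :=
  comap Prod.fst (cobounded X) ⊓ 𝓟 {p | dist p.2 p.1 < r}

/-- Slowly oscillating maps into a uniform space: points that stay at bounded distance while
going to infinity have asymptotically equal images. -/
def SlowOsc {X Y : Type*} [MetricSpace X] [UniformSpace Y] (ψ : X → Y) : Prop :=
  ∀ r, Tendsto (Prod.map ψ ψ) (closePairsAtInfinity X r) (uniformity Y)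

theorem SlowOsc.comp_uniformContinuous {X Y Z : Type*} [MetricSpace X] [UniformSpace Y]
    [UniformSpace Z] {ψ : X → Y} (h : SlowOsc ψ) {u : Y → Z} (hu : UniformContinuous u) :
    SlowOsc (u ∘ ψ) :=
  fun r => Tendsto.comp hu (h r)

theorem slowOsc_iff {X Y : Type*} [MetricSpace X] [PseudoMetricSpace Y] {ψ : X → Y} :
    SlowOsc ψ ↔ ∀ r, ∀ ε > (0 : ℝ), ∀ᶠ x in cobounded X, ∀ y, dist y x < r →
      dist (ψ y) (ψ x) < ε := by
  refine forall_congr' fun r => ?_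
  rw [uniformity_basis_dist.tendsto_right_iff]
  refine forall₂_congr fun ε _ => ?_
  rw [closePairsAtInfinity, eventually_inf_principal, eventually_comap]
  refine eventually_congr (Eventually.of_forall fun x => ⟨fun h y hy => ?_, ?_⟩)
  · rw [dist_comm]
    exact h (x, y) rfl hy
  · rintro h ⟨_, y⟩ rfl hy
    have := h y hy
    rwa [dist_comm] at this

theorem slowlyOscillating_iff_slowOsc {X : Type*} [MetricSpace X] [ProperSpace X] {φ : X → ℝ} :
    SlowlyOscillating φ ↔ SlowOsc φ := by
  rw [slowOsc_iff]
  constructor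
  · intro h r ε hε
    obtain ⟨K, hK, hKr⟩ := h (max r 1) (lt_max_of_lt_right one_pos) ε hε
    rw [cobounded_eq_cocompact]
    filter_upwards [hK.compl_mem_cocompact] with x hx y hy
    exact hKr x hx y (hy.trans_le (le_max_left _ _))
  · intro h r _ ε hε
    have := h r ε hε
    rw [cobounded_eq_cocompact, Filter.Eventually, mem_cocompact] at this
    obtain ⟨K, hK, hKs⟩ := this
    exact ⟨K, hK, fun x hx y hy => hKs hx y hy⟩

/-- A quotient of an asymptotically Lipschitz map by an asymptotically Lipschitz function that
dominates it and tends to infinity is slowly oscillating. -/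
theorem slowOsc_inv_smul {X V : Type*} [MetricSpace X] [NormedAddCommGroup V]
    [NormedSpace ℝ V] {p : X → V} {q : X → ℝ} {C : ℝ} (hp : AsympLipschitz p)
    (hq : AsympLipschitz q) (hq0 : ∀ x, 0 < q x) (hpq : ∀ x, ‖p x‖ ≤ C * q x)
    (hqt : Tendsto q (cobounded X) atTop) : SlowOsc fun x => (q x)⁻¹ • p x := by
  obtain ⟨a, ha, b, hb, hp⟩ := hp
  obtain ⟨c, hc, d, hd, hq⟩ := hq
  rw [slowOsc_iff]
  intro r ε hε
  set D := (a * |r| + b) + |C| * (c * |r| + d) with hD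
  filter_upwards [hqt.eventually_gt_atTop (D / ε)] with x hx y hy
  have hxy : dist y x ≤ |r| := hy.le.trans (le_abs_self r)
  have h1 : ‖p y - p x‖ ≤ a * |r| + b := by
    rw [← dist_eq_norm]
    have := mul_le_mul_of_nonneg_left hxy ha.le
    linarith [hp y x]
  have h2 : |q x - q y| ≤ c * |r| + d := by
    rw [← Real.dist_eq, dist_comm]
    have := mul_le_mul_of_nonneg_left hxy hc.le
    linarith [hq y x]
  have h3 : ‖(q y)⁻¹ • p y‖ ≤ |C| := by
    rw [norm_smul, norm_inv, Real.norm_of_nonneg (hq0 y).le, inv_mul_le_iff₀ (hq0 y), mul_comm]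
    exact (hpq y).trans (mul_le_mul_of_nonneg_right (le_abs_self C) (hq0 y).le)
  have hqx := (hq0 x).ne'
  have hqy := (hq0 y).ne'
  have h4 : (q y)⁻¹ • p y - (q x)⁻¹ • p x
      = (q x)⁻¹ • ((p y - p x) + (q x - q y) • ((q y)⁻¹ • p y)) := by
    rw [smul_add, smul_sub, smul_smul, smul_smul,
      show (q x)⁻¹ * (q x - q y) * (q y)⁻¹ = (q y)⁻¹ - (q x)⁻¹ by field_simp, sub_smul]
    abel
  rw [dist_eq_norm, h4, norm_smul, norm_inv, Real.norm_of_nonneg (hq0 x).le,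
    inv_mul_lt_iff₀ (hq0 x)]
  calc ‖(p y - p x) + (q x - q y) • ((q y)⁻¹ • p y)‖
      ≤ ‖p y - p x‖ + |q x - q y| * ‖(q y)⁻¹ • p y‖ := by
        refine (norm_add_le _ _).trans ?_
        rw [norm_smul, Real.norm_eq_abs]
    _ ≤ (a * |r| + b) + (c * |r| + d) * |C| :=
        add_le_add h1 (mul_le_mul h2 h3 (norm_nonneg _) (by positivity))
    _ = D := by rw [hD]; ring
    _ < q x * ε := by rwa [div_lt_iff₀ hε] at hx

/-! ### Slowly growing functions -/

/-- Given countably many properties, each of which holds near infinity, some function tends to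
infinity so slowly that the `k`-th property holds wherever it exceeds `k`. -/
theorem exists_lipschitz_tendsto_atTop {X : Type*} [MetricSpace X] {Q : ℕ → X → Prop}
    (hQ : ∀ k, ∀ᶠ x in cobounded X, Q k x) :
    ∃ τ : X → ℝ, LipschitzWith 1 τ ∧ (∀ x, 0 ≤ τ x) ∧ Tendsto τ (cobounded X) atTop ∧
      ∀ k : ℕ, ∀ x, k < τ x → Q k x := by
  rcases isEmpty_or_nonempty X with hX | ⟨⟨x₀⟩⟩
  · exact ⟨fun _ => 0, LipschitzWith.of_le_add fun x => hX.elim x, fun _ => le_rfl,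
      by rw [filter_eq_bot_of_isEmpty (cobounded X)]; exact tendsto_bot, fun _ x => hX.elim x⟩
  have hR : ∀ k, ∃ R : ℝ, ∀ x, R < dist x x₀ → Q k x := by
    intro k
    obtain ⟨R, -, hR⟩ := (hasBasis_cobounded_compl_closedBall x₀).eventually_iff.1 (hQ k)
    exact ⟨R, fun x hx => hR (by simpa using hx)⟩
  choose R hR using hR
  set T : ℕ → X → ℝ := fun k x => (k : ℝ) + max 0 (dist x x₀ - R k) with hT
  have hT0 : ∀ (k : ℕ) (x : X), (k : ℝ) ≤ T k x := fun k x => le_add_of_nonneg_right (le_max_left _ _)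
  have hbdd : ∀ x, BddBelow (range fun k => T k x) := fun x =>
    ⟨0, by rintro _ ⟨k, rfl⟩; exact (Nat.cast_nonneg k).trans (hT0 k x)⟩
  refine ⟨fun x => ⨅ k, T k x, ?_, ?_, ?_, ?_⟩
  · refine LipschitzWith.of_le_add fun x y => ?_
    rw [← sub_le_iff_le_add]
    refine le_ciInf fun k => ?_
    rw [sub_le_iff_le_add]
    refine (ciInf_le (hbdd x) k).trans ?_
    have h1 : max 0 (dist x x₀ - R k) ≤ max 0 (dist y x₀ - R k) + dist x y := by
      refine max_le (add_nonneg (le_max_left _ _) dist_nonneg) ?_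
      linarith [dist_triangle x y x₀, le_max_right 0 (dist y x₀ - R k)]
    simp only [hT]
    linarith
  · exact fun x => le_ciInf fun k => (Nat.cast_nonneg k).trans (hT0 k x)
  · refine Filter.tendsto_atTop.2 fun M => ?_
    obtain ⟨m, hm⟩ := exists_nat_ge M
    have hev : ∀ᶠ x in cobounded X, ∀ k ∈ Finset.range m, R k + m ≤ dist x x₀ := by
      rw [eventually_all_finset]
      intro k _
      filter_upwards [(tendsto_dist_left_cobounded_atTop x₀).eventually_ge_atTop (R k + m)]
        with x hx
      rwa [dist_comm]
    filter_upwards [hev] with x hx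
    refine hm.trans (le_ciInf fun k => ?_)
    rcases lt_or_ge k m with hk | hk
    · have h1 := hx k (Finset.mem_range.2 hk)
      have h2 := le_max_right 0 (dist x x₀ - R k)
      have : (0 : ℝ) ≤ k := Nat.cast_nonneg k
      simp only [hT]
      linarith
    · exact (Nat.cast_le.2 hk).trans (hT0 k x)
  · intro k x hx
    refine hR k x (lt_of_not_ge fun hle => ?_)
    have := hx.trans_le (ciInf_le (hbdd x) k)
    simp [hT, hle] at this

/-- A slowly oscillating map becomes asymptotically Lipschitz after scaling by a suitable slowly
growing function, which may also be kept below any function tending to infinity on a set `A`. -/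
theorem SlowOsc.exists_slow {X Y : Type*} [MetricSpace X] [PseudoMetricSpace Y] {ψ : X → Y}
    (hψ : SlowOsc ψ) {A : Set X} {ρ : X → ℝ}
    (hρ : ∀ M, ∀ᶠ x in cobounded X, x ∈ A → M ≤ ρ x) :
    ∃ τ : X → ℝ, LipschitzWith 1 τ ∧ (∀ x, 0 ≤ τ x) ∧ Tendsto τ (cobounded X) atTop ∧
      (∀ x ∈ A, 0 < τ x → τ x ≤ ρ x) ∧
      ∀ x y, dist y x < τ x → τ x * dist (ψ y) (ψ x) ≤ 1 := by
  have hk0 : ∀ k : ℕ, (0 : ℝ) < k + 1 := fun k => by positivity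
  have hQ : ∀ k : ℕ, ∀ᶠ x in cobounded X, (x ∈ A → (k : ℝ) + 1 ≤ ρ x) ∧
      ∀ y, dist y x < (k : ℝ) + 1 → dist (ψ y) (ψ x) < ((k : ℝ) + 1)⁻¹ :=
    fun k => (hρ _).and (slowOsc_iff.1 hψ _ _ (inv_pos.2 (hk0 k)))
  obtain ⟨τ, hτl, hτ0, hτt, hτ⟩ := exists_lipschitz_tendsto_atTop hQ
  -- the integer `k` with `k < τ x ≤ k + 1`
  have hceil : ∀ x, 0 < τ x → ∃ k : ℕ, (k : ℝ) < τ x ∧ τ x ≤ k + 1 := by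
    intro x hx
    have hc : 0 < ⌈τ x⌉₊ := Nat.ceil_pos.2 hx
    refine ⟨⌈τ x⌉₊ - 1, Nat.lt_ceil.1 (Nat.sub_one_lt hc.ne'), ?_⟩
    rw [← Nat.cast_add_one, Nat.sub_one_add_one hc.ne']
    exact Nat.le_ceil _
  refine ⟨τ, hτl, hτ0, hτt, fun x hx hpos => ?_, fun x y hxy => ?_⟩
  · obtain ⟨k, h1, h2⟩ := hceil x hpos
    exact h2.trans ((hτ k x h1).1 hx)
  · obtain ⟨k, h1, h2⟩ := hceil x (dist_nonneg.trans_lt hxy)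
    have h3 := (hτ k x h1).2 y (hxy.trans_le h2)
    calc τ x * dist (ψ y) (ψ x) ≤ (k + 1) * ((k : ℝ) + 1)⁻¹ :=
          mul_le_mul h2 h3.le dist_nonneg (hk0 k).le
      _ = 1 := mul_inv_cancel₀ (hk0 k).ne'

/-! ### Polar coordinates on the open cone -/

namespace OpenCone

variable {L : Type*} [MetricSpace L] {hd : ∀ x y : L, dist x y ≤ 1}

/-- The point of the open cone with direction `x` and radius `t`; negative `t` are read as `0`. -/
def point (hd : ∀ x y : L, dist x y ≤ 1) (x : L) (t : ℝ) : OpenCone L hd :=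
  Quotient.mk (coneSetoid L) (x, t.toNNReal)

/-- The distance to the apex. -/
noncomputable def radius (c : OpenCone L hd) : ℝ :=
  (Quotient.out (s := coneSetoid L) c).2

/-- The direction of a point of the open cone; at the apex, an arbitrary point of `L`. -/
noncomputable def direction (c : OpenCone L hd) : L :=
  (Quotient.out (s := coneSetoid L) c).1

theorem radius_nonneg (c : OpenCone L hd) : 0 ≤ c.radius := NNReal.coe_nonneg _

theorem point_direction_radius (c : OpenCone L hd) : point hd c.direction c.radius = c := by
  have : (c.radius).toNNReal = (Quotient.out (s := coneSetoid L) c).2 := Real.toNNReal_coe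
  rw [point, this]
  exact Quotient.out_eq (s := coneSetoid L) c

theorem dist_point_point (x y : L) (s t : ℝ) : dist (point hd x s) (point hd y t) =
    |max s 0 - max t 0| + min (max s 0) (max t 0) * dist x y := by
  change coneDist _ _ = _
  simp [coneDist, Real.coe_toNNReal']

theorem dist_point_point_of_nonneg (x y : L) {s t : ℝ} (hs : 0 ≤ s) (ht : 0 ≤ t) :
    dist (point hd x s) (point hd y t) = |s - t| + min s t * dist x y := by
  rw [dist_point_point, max_eq_left hs, max_eq_left ht]

theorem dist_eq (c d : OpenCone L hd) : dist c d = |c.radius - d.radius| +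
    min c.radius d.radius * dist c.direction d.direction := by
  conv_lhs => rw [← point_direction_radius c, ← point_direction_radius d]
  exact dist_point_point_of_nonneg _ _ c.radius_nonneg d.radius_nonneg

theorem abs_radius_sub_le_dist (c d : OpenCone L hd) : |c.radius - d.radius| ≤ dist c d := by
  rw [dist_eq]
  exact le_add_of_nonneg_right
    (mul_nonneg (le_min c.radius_nonneg d.radius_nonneg) dist_nonneg)

theorem min_radius_mul_dist_direction_le (c d : OpenCone L hd) :
    min c.radius d.radius * dist c.direction d.direction ≤ dist c d := by
  rw [dist_eq]
  exact le_add_of_nonneg_left (abs_nonneg _)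

theorem lipschitzWith_radius : LipschitzWith 1 (radius : OpenCone L hd → ℝ) :=
  LipschitzWith.of_dist_le_mul fun c d => by
    simpa [Real.dist_eq] using abs_radius_sub_le_dist c d

theorem radius_point (x : L) {t : ℝ} (ht : 0 ≤ t) : (point hd x t).radius = t := by
  have h1 := dist_point_point_of_nonneg (hd := hd) (point hd x t).direction x
    (point hd x t).radius_nonneg ht
  rw [point_direction_radius, dist_self] at h1
  have h2 := mul_nonneg (le_min (point hd x t).radius_nonneg ht)
    (dist_nonneg (x := (point hd x t).direction) (y := x))
  have h3 := abs_nonneg ((point hd x t).radius - t)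
  exact sub_eq_zero.1 (abs_eq_zero.1 (by linarith))

theorem direction_point (x : L) {t : ℝ} (ht : 0 < t) : (point hd x t).direction = x := by
  have h1 := dist_point_point_of_nonneg (hd := hd) (point hd x t).direction x
    (point hd x t).radius_nonneg ht.le
  rw [point_direction_radius, dist_self, radius_point x ht.le, sub_self, abs_zero, min_self,
    zero_add] at h1
  exact dist_eq_zero.1 ((mul_eq_zero.1 h1.symm).resolve_left ht.ne')

theorem continuous_point : Continuous fun p : L × ℝ => point hd p.1 p.2 := by
  refine continuous_iff_continuousAt.2 fun p => tendsto_iff_dist_tendsto_zero.2 ?_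
  simp only [dist_point_point]
  have : Continuous fun q : L × ℝ =>
      |max q.2 0 - max p.2 0| + min (max q.2 0) (max p.2 0) * dist q.1 p.1 := by fun_prop
  simpa using this.tendsto p

theorem isCompact_radius_le [CompactSpace L] (M : ℝ) :
    IsCompact {c : OpenCone L hd | c.radius ≤ M} := by
  refine ((isCompact_univ (X := L)).prod (isCompact_Icc (a := (0 : ℝ)) (b := M))).image
    (continuous_point (hd := hd)) |>.of_isClosed_subset
    (isClosed_le lipschitzWith_radius.continuous continuous_const) fun c hc => ?_
  exact ⟨(c.direction, c.radius), ⟨mem_univ _, c.radius_nonneg, hc⟩, point_direction_radius c⟩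

theorem exists_radius_le_of_isCompact {K : Set (OpenCone L hd)} (hK : IsCompact K) :
    ∃ M, ∀ c ∈ K, c.radius ≤ M := by
  obtain ⟨M, hM⟩ := hK.bddAbove_image (f := radius) lipschitzWith_radius.continuous.continuousOn
  exact ⟨M, fun c hc => hM (mem_image_of_mem _ hc)⟩

end OpenCone

/-- The radius of a proper map into the open cone tends to infinity. -/
theorem IsAsympMorphism.eventually_le_radius {L : Type*} [MetricSpace L] [CompactSpace L]
    {hd : ∀ x y : L, dist x y ≤ 1} {X : Type*} [MetricSpace X] {A : Set X}
    {f : A → OpenCone L hd} (hf : IsAsympMorphism f) (M : ℝ) :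
    ∀ᶠ x in cobounded X, ∀ h : x ∈ A, M ≤ (f ⟨x, h⟩).radius := by
  have hK := (hf.isCompact_preimage _ (OpenCone.isCompact_radius_le M)).image
    continuous_subtype_val
  filter_upwards [isBounded_def.1 hK.isBounded] with x hx h
  by_contra hlt
  exact hx ⟨⟨x, h⟩, (not_le.1 hlt).le, rfl⟩

/-- A map into the open cone whose radius tends to infinity is proper. -/
theorem isCompact_preimage_of_tendsto_radius {L : Type*} [MetricSpace L]
    {hd : ∀ x y : L, dist x y ≤ 1} {Y : Type*} [TopologicalSpace Y] {f : Y → OpenCone L hd}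
    (hf : Continuous f) (ht : Tendsto (fun y => (f y).radius) (cocompact Y) atTop)
    {K : Set (OpenCone L hd)} (hK : IsCompact K) : IsCompact (f ⁻¹' K) := by
  obtain ⟨M, hM⟩ := OpenCone.exists_radius_le_of_isCompact hK
  obtain ⟨Q, hQ, hQs⟩ := mem_cocompact.1 (ht.eventually_gt_atTop M)
  refine hQ.of_isClosed_subset (hK.isClosed.preimage hf) fun y hy => ?_
  by_contra hn
  exact (hM _ hy).not_gt (hQs hn)

/-! ### The open cone as a Lipschitz retract -/

theorem min_mul_norm_sub_le {V : Type*} [NormedAddCommGroup V] [NormedSpace ℝ V]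
    {s t C : ℝ} (hs : 0 ≤ s) (ht : 0 ≤ t) {a b : V} (ha : ‖a‖ ≤ C) (hb : ‖b‖ ≤ C) :
    min s t * ‖a - b‖ ≤ ‖s • a - t • b‖ + |s - t| * C := by
  wlog hst : s ≤ t generalizing s t a b
  · have := this ht hs hb ha (le_of_not_ge hst)
    rwa [min_comm, norm_sub_rev, norm_sub_rev (s • a), abs_sub_comm]
  rw [min_eq_left hst, ← Real.norm_of_nonneg hs, ← norm_smul, Real.norm_of_nonneg hs,
    show s • (a - b) = (s • a - t • b) - (s - t) • b by rw [smul_sub, sub_smul]; abel]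
  refine (norm_sub_le _ _).trans ?_
  rw [norm_smul, Real.norm_eq_abs]
  exact add_le_add_right (mul_le_mul_of_nonneg_left hb (abs_nonneg _)) _

theorem norm_smul_sub_smul_le {V : Type*} [NormedAddCommGroup V] [NormedSpace ℝ V]
    {s t C : ℝ} (hs : 0 ≤ s) (ht : 0 ≤ t) {a b : V} (ha : ‖a‖ ≤ C) (hb : ‖b‖ ≤ C) :
    ‖s • a - t • b‖ ≤ min s t * ‖a - b‖ + |s - t| * C := by
  wlog hst : s ≤ t generalizing s t a b
  · have := this ht hs hb ha (le_of_not_ge hst)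
    rwa [min_comm, norm_sub_rev a, norm_sub_rev, abs_sub_comm]
  rw [min_eq_left hst, show s • a - t • b = s • (a - b) + (s - t) • b by
    rw [smul_sub, sub_smul]; abel]
  refine (norm_add_le _ _).trans ?_
  rw [norm_smul, norm_smul, Real.norm_of_nonneg hs, Real.norm_eq_abs]
  exact add_le_add_right (mul_le_mul_of_nonneg_left hb (abs_nonneg _)) _

/-- A Lipschitz embedding of `L` into a euclidean space with a left inverse `r` that is Lipschitz
on the closed `η`-neighborhood of the image. -/
structure TubularRetraction (L : Type*) [MetricSpace L] (n : ℕ) where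
  /-- The embedding. -/
  e : L → EuclideanSpace ℝ (Fin n)
  /-- The retraction, read in `L`. -/
  r : EuclideanSpace ℝ (Fin n) → L
  /-- The width of the tube. -/
  η : ℝ
  /-- A Lipschitz constant of the embedding. -/
  Ke : ℝ≥0
  /-- A Lipschitz constant of the retraction. -/
  Kr : ℝ≥0
  η_pos : 0 < η
  lipschitz_e : LipschitzWith Ke e
  lipschitz_r : LipschitzOnWith Kr r (cthickening η (range e))
  r_e : ∀ x, r (e x) = x

theorem IsALNER.exists_tubularRetraction {L : Type*} [MetricSpace L] [CompactSpace L]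
    (hL : IsALNER L) : ∃ n, Nonempty (TubularRetraction L n) := by
  obtain ⟨n, e, ⟨Ke, hKe⟩, -, U, hU, heU, r, ⟨Kr, hKr⟩, hr⟩ := hL
  obtain ⟨η, hη, hηU⟩ := (isCompact_range hKe.continuous).exists_cthickening_subset_open hU heU
  exact ⟨n, ⟨⟨e, r, η, Ke, Kr, hη, hKe, hKr.mono hηU, hr⟩⟩⟩

namespace TubularRetraction

variable {L : Type*} [MetricSpace L] {n : ℕ} (T : TubularRetraction L n)

/-- The closed tube on which the retraction is Lipschitz. -/
def tube : Set (EuclideanSpace ℝ (Fin n)) := cthickening T.η (range T.e)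

theorem isClosed_tube : IsClosed T.tube := isClosed_cthickening

theorem continuousOn_r : ContinuousOn T.r T.tube := T.lipschitz_r.continuousOn

theorem tube_mem_nhds (x : L) : T.tube ∈ 𝓝 (T.e x) :=
  mem_of_superset (isOpen_thickening.mem_nhds
    (self_subset_thickening T.η_pos _ (mem_range_self x))) (thickening_subset_cthickening _ _)

theorem mem_tube_of_dist_le {v : EuclideanSpace ℝ (Fin n)} {x : L} (h : dist v (T.e x) ≤ T.η) :
    v ∈ T.tube :=
  mem_cthickening_of_dist_le _ _ _ _ (mem_range_self x) h

theorem dist_r_le {v w : EuclideanSpace ℝ (Fin n)} (hv : v ∈ T.tube) (hw : w ∈ T.tube) :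
    dist (T.r v) (T.r w) ≤ T.Kr * dist v w :=
  T.lipschitz_r.dist_le_mul _ hv _ hw

theorem isClosedEmbedding_e [CompactSpace L] : IsClosedEmbedding T.e :=
  T.lipschitz_e.continuous.isClosedEmbedding (Function.LeftInverse.injective T.r_e)

theorem exists_norm_e_le [CompactSpace L] : ∃ C, 0 ≤ C ∧ ∀ x, ‖T.e x‖ ≤ C := by
  obtain ⟨C, hC⟩ := (isCompact_range T.lipschitz_e.continuous).isBounded.exists_norm_le
  exact ⟨max C 0, le_max_right _ _, fun x => (hC _ (mem_range_self x)).trans (le_max_left _ _)⟩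

variable {hd : ∀ x y : L, dist x y ≤ 1}

/-- The map `[x, t] ↦ t • e x` of the open cone into the euclidean space. -/
noncomputable def coneE (c : OpenCone L hd) : EuclideanSpace ℝ (Fin n) :=
  c.radius • T.e c.direction

theorem exists_lipschitzWith_coneE [CompactSpace L] :
    ∃ K, LipschitzWith K (T.coneE : OpenCone L hd → EuclideanSpace ℝ (Fin n)) := by
  obtain ⟨C, hC0, hC⟩ := T.exists_norm_e_le
  refine ⟨T.Ke + C.toNNReal, LipschitzWith.of_dist_le_mul fun c d => ?_⟩
  rw [dist_eq_norm, NNReal.coe_add, Real.coe_toNNReal _ hC0, add_mul]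
  refine (norm_smul_sub_smul_le c.radius_nonneg d.radius_nonneg (hC _) (hC _)).trans
    (add_le_add ?_ ?_)
  · rw [← dist_eq_norm]
    calc min c.radius d.radius * dist (T.e c.direction) (T.e d.direction)
        ≤ min c.radius d.radius * (T.Ke * dist c.direction d.direction) :=
          mul_le_mul_of_nonneg_left (T.lipschitz_e.dist_le_mul _ _)
            (le_min c.radius_nonneg d.radius_nonneg)
      _ = T.Ke * (min c.radius d.radius * dist c.direction d.direction) := by ring
      _ ≤ T.Ke * dist c d :=
          mul_le_mul_of_nonneg_left (OpenCone.min_radius_mul_dist_direction_le c d) T.Ke.2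
  · rw [mul_comm]
    exact mul_le_mul_of_nonneg_left (OpenCone.abs_radius_sub_le_dist c d) hC0

/-- The open cone is a Lipschitz retract of `ℝ × ℝⁿ`. The retraction sends `(t, v)` to direction
`r (t⁻¹ • v)` and to a radius that vanishes unless `(t, v)` is close to the embedded cone relative
to `t`; where the radius is positive, `t⁻¹ • v` lies in the tube. -/
theorem exists_cone_retraction [CompactSpace L] [Nonempty L]
    (hd : ∀ x y : L, dist x y ≤ 1) :
    ∃ ρ : ℝ × EuclideanSpace ℝ (Fin n) → OpenCone L hd, (∃ K, LipschitzWith K ρ) ∧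
      ∀ c, ρ (c.radius, T.coneE c) = c := by
  obtain ⟨C, hC0, hC⟩ := T.exists_norm_e_le
  have hη := T.η_pos
  set S : Set (ℝ × EuclideanSpace ℝ (Fin n)) :=
    range fun c : OpenCone L hd => (c.radius, T.coneE c)
  have hSne : S.Nonempty := ⟨_, ⟨OpenCone.point hd (Classical.arbitrary L) 0, rfl⟩⟩
  set M : ℝ := (1 + C) / T.η with hM
  have hM0 : 0 < M := by positivity
  set τ : ℝ × EuclideanSpace ℝ (Fin n) → ℝ := fun p => max 0 (p.1 - M * infDist p S) with hτ
  have hτ0 : ∀ p, 0 ≤ τ p := fun p => le_max_left _ _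
  have hle : ∀ p, 0 < τ p → τ p ≤ p.1 := by
    intro p hp
    have h1 : 0 ≤ M * infDist p S := mul_nonneg hM0.le infDist_nonneg
    rcases max_choice 0 (p.1 - M * infDist p S) with h | h
    · simp only [hτ, h, lt_self_iff_false] at hp
    · simp only [hτ, h]
      linarith
  -- the direction of a point with positive radius lies in the tube
  have htube : ∀ p, 0 < τ p → ∃ x : L, dist (p.1⁻¹ • p.2) (T.e x) ≤ T.η := by
    intro p hp
    have ht : 0 < p.1 := hp.trans_le (hle p hp)
    have h1 : infDist p S < p.1 / M := by
      rw [lt_div_iff₀ hM0]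
      rcases lt_max_iff.1 hp with h | h
      · exact absurd h (lt_irrefl _)
      · linarith
    obtain ⟨_, ⟨c, rfl⟩, hc⟩ := (infDist_lt_iff hSne).1 h1
    have hc1 : |p.1 - c.radius| < p.1 / M := (le_max_left _ _).trans_lt hc
    have hc2 : ‖p.2 - T.coneE c‖ < p.1 / M := by
      rw [← dist_eq_norm]
      exact (le_max_right _ _).trans_lt hc
    refine ⟨c.direction, ?_⟩
    have h2 : p.1⁻¹ • p.2 - T.e c.direction =
        p.1⁻¹ • ((p.2 - T.coneE c) - (p.1 - c.radius) • T.e c.direction) := by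
      rw [coneE, sub_smul, sub_sub_sub_cancel_right, smul_sub, smul_smul,
        inv_mul_cancel₀ ht.ne', one_smul]
    rw [dist_eq_norm, h2, norm_smul, norm_inv, Real.norm_of_nonneg ht.le, inv_mul_le_iff₀ ht]
    refine (norm_sub_le _ _).trans ?_
    rw [norm_smul, Real.norm_eq_abs]
    have h3 : |p.1 - c.radius| * ‖T.e c.direction‖ ≤ p.1 / M * C :=
      mul_le_mul hc1.le (hC _) (norm_nonneg _) (by positivity)
    calc _ ≤ p.1 / M + p.1 / M * C := add_le_add hc2.le h3
      _ = p.1 * T.η := by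
        rw [hM]
        field_simp
  have hnorm : ∀ p, 0 < τ p → ‖p.1⁻¹ • p.2‖ ≤ C + T.η := by
    intro p hp
    obtain ⟨x, hx⟩ := htube p hp
    rw [dist_eq_norm] at hx
    linarith [norm_le_norm_add_norm_sub' (p.1⁻¹ • p.2) (T.e x), hC x]
  refine ⟨fun p => OpenCone.point hd (T.r (p.1⁻¹ • p.2)) (τ p), ⟨(1 + M).toNNReal +
    T.Kr * (1 + (C + T.η)).toNNReal, LipschitzWith.of_dist_le_mul fun p q => ?_⟩, fun c => ?_⟩
  · have h1 : |τ p - τ q| ≤ (1 + M) * dist p q := by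
      have hi : |infDist p S - infDist q S| ≤ dist p q := by
        simpa [Real.dist_eq] using (lipschitz_infDist_pt S).dist_le_mul p q
      have hf : |p.1 - q.1| ≤ dist p q := le_max_left _ _
      have h2 : |τ p - τ q| ≤ |(p.1 - M * infDist p S) - (q.1 - M * infDist q S)| := by
        simp only [hτ, max_comm (0 : ℝ)]
        exact abs_max_sub_max_le_abs _ _ _
      refine h2.trans ?_
      rw [show (p.1 - M * infDist p S) - (q.1 - M * infDist q S)
        = (p.1 - q.1) - M * (infDist p S - infDist q S) by ring]
      refine (abs_sub _ _).trans ?_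
      rw [abs_mul, abs_of_pos hM0]
      have := mul_le_mul_of_nonneg_left hi hM0.le
      linarith
    have h2 : min (τ p) (τ q) * dist (T.r (p.1⁻¹ • p.2)) (T.r (q.1⁻¹ • q.2)) ≤
        T.Kr * (1 + (C + T.η)) * dist p q := by
      rcases (hτ0 p).eq_or_lt with hp | hp
      · rw [← hp, min_eq_left (hτ0 q), zero_mul]
        positivity
      rcases (hτ0 q).eq_or_lt with hq | hq
      · rw [← hq, min_eq_right (hτ0 p), zero_mul]
        positivity
      have hp1 : 0 < p.1 := hp.trans_le (hle p hp)
      have hq1 : 0 < q.1 := hq.trans_le (hle q hq)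
      obtain ⟨x, hx⟩ := htube p hp
      obtain ⟨y, hy⟩ := htube q hq
      have h3 := T.dist_r_le (T.mem_tube_of_dist_le hx) (T.mem_tube_of_dist_le hy)
      have h4 := min_mul_norm_sub_le hp1.le hq1.le (hnorm p hp) (hnorm q hq)
      rw [smul_inv_smul₀ hp1.ne', smul_inv_smul₀ hq1.ne'] at h4
      have h5 : ‖p.2 - q.2‖ ≤ dist p q := by
        rw [← dist_eq_norm]
        exact le_max_right _ _
      have h6 : |p.1 - q.1| ≤ dist p q := le_max_left _ _
      have h7 : 0 ≤ C + T.η := by positivity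
      calc _ ≤ min p.1 q.1 * (T.Kr * dist (p.1⁻¹ • p.2) (q.1⁻¹ • q.2)) :=
            mul_le_mul (min_le_min (hle p hp) (hle q hq)) h3 dist_nonneg
              (le_min hp1.le hq1.le)
        _ = T.Kr * (min p.1 q.1 * ‖p.1⁻¹ • p.2 - q.1⁻¹ • q.2‖) := by rw [dist_eq_norm]; ring
        _ ≤ T.Kr * (dist p q + dist p q * (C + T.η)) :=
            mul_le_mul_of_nonneg_left (h4.trans (add_le_add h5
              (mul_le_mul_of_nonneg_right h6 h7))) T.Kr.2
        _ = _ := by ring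
    rw [OpenCone.dist_point_point_of_nonneg _ _ (hτ0 p) (hτ0 q), NNReal.coe_add, NNReal.coe_mul,
      Real.coe_toNNReal _ (by positivity), Real.coe_toNNReal _ (by positivity), add_mul]
    exact add_le_add h1 h2
  · have h1 : τ (c.radius, T.coneE c) = c.radius := by
      have : infDist (c.radius, T.coneE c) S = 0 := infDist_zero_of_mem ⟨c, rfl⟩
      simp [hτ, this, c.radius_nonneg]
    simp only [h1]
    rcases c.radius_nonneg.eq_or_lt with h | h
    · -- at the apex the direction is irrelevant
      refine dist_eq_zero.1 ?_
      conv_lhs => rw [← OpenCone.point_direction_radius c]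
      rw [OpenCone.point_direction_radius, OpenCone.dist_eq,
        OpenCone.radius_point _ c.radius_nonneg, ← h]
      simp
    · rw [coneE, inv_smul_smul₀ h.ne', T.r_e, OpenCone.point_direction_radius]

/-- Without properness, the open cone is an absolute extensor for continuous asymptotically
Lipschitz maps. -/
theorem exists_extension_openCone (T : TubularRetraction L n) [CompactSpace L] [Nonempty L]
    {X : Type*} [MetricSpace X] {S : Set X} (hS : IsClosed S) {f : S → OpenCone L hd}
    (hf : Continuous f) (hfl : AsympLipschitz f) :
    ∃ g : X → OpenCone L hd, Continuous g ∧ AsympLipschitz g ∧ ∀ s : S, g s = f s := by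
  obtain ⟨ρ, ⟨K, hρ⟩, hρc⟩ := T.exists_cone_retraction hd
  obtain ⟨K', hE⟩ := T.exists_lipschitzWith_coneE (hd := hd)
  obtain ⟨t, htc, htl, ht⟩ := AsympLipschitz.exists_extension_real hS
    (OpenCone.lipschitzWith_radius.continuous.comp hf)
    (OpenCone.lipschitzWith_radius.comp_asympLipschitz hfl)
  obtain ⟨v, hvc, hvl, hv⟩ := AsympLipschitz.exists_extension_euclideanSpace hS
    (hE.continuous.comp hf) (hE.comp_asympLipschitz hfl)
  refine ⟨fun x => ρ (t x, v x), hρ.continuous.comp (htc.prodMk hvc),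
    hρ.comp_asympLipschitz (htl.prodMk hvl), fun s => ?_⟩
  simp only [ht, hv]
  exact hρc (f s)

end TubularRetraction

/-! ### The Higson compactification -/

section Higson

variable {X : Type*} [MetricSpace X]

/-- The canonical map of `X` into its Higson compactification. -/
def toHigson (x : X) : higsonCompactification X :=
  ⟨higsonMap X x, subset_closure (mem_range_self x)⟩

theorem continuous_toHigson : Continuous (toHigson : X → higsonCompactification X) :=
  Continuous.subtype_mk (continuous_pi fun φ => φ.1.continuous) _

theorem dense_range_toHigson : DenseRange (toHigson : X → higsonCompactification X) := by
  intro p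
  rw [closure_subtype, ← range_comp]
  exact p.2

instance : CompactSpace (higsonCompactification X) := by
  refine isCompact_iff_compactSpace.1
    ((isCompact_univ_pi fun φ : HigsonFunction X => isCompact_closedBall (0 : ℝ) ‖φ.1‖)
      |>.of_isClosed_subset isClosed_closure (closure_minimal ?_ ?_))
  · rintro _ ⟨x, rfl⟩ φ -
    exact mem_closedBall_zero_iff.2 (φ.1.norm_coe_le_norm x)
  · exact isClosed_set_pi fun φ _ => isClosed_closedBall

theorem slowOsc_toHigson [ProperSpace X] :
    SlowOsc (toHigson : X → higsonCompactification X) := by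
  intro r
  rw [uniformity_subtype, tendsto_comap_iff, Pi.uniformity, tendsto_iInf]
  intro φ
  rw [tendsto_comap_iff]
  exact slowlyOscillating_iff_slowOsc.1 φ.2 r

theorem slowOsc_comp_toHigson [ProperSpace X] {V : Type*} [UniformSpace V]
    {u : higsonCompactification X → V} (hu : Continuous u) :
    SlowOsc fun x : X => u (toHigson x) :=
  slowOsc_toHigson.comp_uniformContinuous (CompactSpace.uniformContinuous_of_continuous hu)

/-- Bounded continuous slowly oscillating maps into `ℝⁿ` extend to the Higson compactification. -/
theorem SlowOsc.exists_extension_higson [ProperSpace X] {n : ℕ}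
    {w : X → EuclideanSpace ℝ (Fin n)} (hwo : SlowOsc w) (hwc : Continuous w) {C : ℝ}
    (hC : ∀ x, ‖w x‖ ≤ C) :
    ∃ u : higsonCompactification X → EuclideanSpace ℝ (Fin n), Continuous u ∧
      ∀ x, u (toHigson x) = w x := by
  have hi : ∀ i, SlowlyOscillating fun x => w x i := by
    intro i
    have hu : UniformContinuous fun v : EuclideanSpace ℝ (Fin n) => v i :=
      (EuclideanSpace.proj i : EuclideanSpace ℝ (Fin n) →L[ℝ] ℝ).uniformContinuous
    have := hwo.comp_uniformContinuous hu
    exact slowlyOscillating_iff_slowOsc.2 this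
  let φ : Fin n → HigsonFunction X := fun i =>
    ⟨BoundedContinuousFunction.ofNormedAddCommGroup (fun x => w x i) (by fun_prop) C
      fun x => (PiLp.norm_apply_le (w x) i).trans (hC x), hi i⟩
  refine ⟨fun p => WithLp.toLp 2 fun i => p.1 (φ i), ?_, fun x => ?_⟩
  · exact (PiLp.continuous_toLp 2 _).comp
      (continuous_pi fun i => (continuous_apply (φ i)).comp continuous_subtype_val)
  · ext i
    rfl

/-- The Higson function `y ↦ max 0 (1 - d(y, x₀))`, supported in a compact ball. -/
theorem exists_higsonFunction_bump [ProperSpace X] (x₀ : X) :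
    ∃ φ : HigsonFunction X, 0 < φ.1 x₀ ∧ ∀ x, 0 < φ.1 x → x ∈ closedBall x₀ 1 := by
  have hb : ∀ x, ‖max 0 (1 - dist x x₀)‖ ≤ 1 := fun x => by
    rw [Real.norm_of_nonneg (le_max_left _ _)]
    exact max_le zero_le_one (by linarith [dist_nonneg (x := x) (y := x₀)])
  refine ⟨⟨BoundedContinuousFunction.ofNormedAddCommGroup (fun x => max 0 (1 - dist x x₀))
    (by fun_prop) 1 hb, ?_⟩, ?_, fun x hx => ?_⟩
  · intro r hr ε hε
    refine ⟨closedBall x₀ (r + 1), isCompact_closedBall _ _, fun x hx y hy => ?_⟩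
    have h1 : r + 1 < dist x x₀ := by simpa using hx
    have h2 : dist y x < r := hy
    have h3 : dist x x₀ ≤ dist y x + dist y x₀ := dist_triangle_left _ _ _
    have h4 : max 0 (1 - dist x x₀) = 0 := max_eq_left (by linarith)
    have h5 : max 0 (1 - dist y x₀) = 0 := max_eq_left (by linarith)
    simpa [h4, h5] using hε
  · simp
  · rcases lt_max_iff.1 (show 0 < max 0 (1 - dist x x₀) from hx) with h | h
    · exact absurd h (lt_irrefl _)
    · exact mem_closedBall.2 (by linarith)

/-- The Higson corona, as a subset of the compactification. -/
def coronaIn (X : Type*) [MetricSpace X] : Set (higsonCompactification X) :=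
  (range toHigson)ᶜ

theorem coe_mem_higsonCorona_iff {p : higsonCompactification X} :
    (p : HigsonFunction X → ℝ) ∈ higsonCorona X ↔ p ∈ coronaIn X := by
  refine ⟨fun h ⟨x, hx⟩ => h.2 ⟨x, congrArg Subtype.val hx⟩, fun h => ⟨p.2, ?_⟩⟩
  rintro ⟨x, hx⟩
  exact h ⟨x, Subtype.ext hx⟩

/-- The inclusion of the corona. -/
def coronaIncl (p : higsonCorona X) : higsonCompactification X :=
  inclusion sdiff_subset p

theorem range_coronaIncl : range (coronaIncl (X := X)) = coronaIn X := by
  ext p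
  constructor
  · rintro ⟨q, rfl⟩
    exact coe_mem_higsonCorona_iff.1 q.2
  · exact fun hp => ⟨⟨p, coe_mem_higsonCorona_iff.2 hp⟩, rfl⟩

/-- Near a point of `X` the compactification is the image of a compact ball, hence contains no
point of the corona. -/
theorem exists_isOpen_toHigson [ProperSpace X] (x₀ : X) :
    ∃ O : Set (higsonCompactification X), IsOpen O ∧ toHigson x₀ ∈ O ∧
      O ⊆ range toHigson ∧ toHigson ⁻¹' O ⊆ closedBall x₀ 1 := by
  obtain ⟨φ, hφ, hφb⟩ := exists_higsonFunction_bump x₀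
  have hopen : IsOpen {p : higsonCompactification X | 0 < p.1 φ} :=
    isOpen_lt continuous_const ((continuous_apply φ).comp continuous_subtype_val)
  refine ⟨_, hopen, hφ, fun p hp => ?_, fun x hx => hφb x hx⟩
  have h1 : p ∈ closure ({p : higsonCompactification X | 0 < p.1 φ} ∩ range toHigson) :=
    dense_range_toHigson.open_subset_closure_inter hopen hp
  have h2 : IsClosed (toHigson '' closedBall x₀ 1) :=
    ((isCompact_closedBall x₀ 1).image continuous_toHigson).isClosed
  have h3 : p ∈ toHigson '' closedBall x₀ 1 := by
    refine closure_minimal ?_ h2 h1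
    rintro _ ⟨hx, x, rfl⟩
    exact mem_image_of_mem _ (hφb x hx)
  exact image_subset_range _ _ h3

theorem isClosed_coronaIn [ProperSpace X] : IsClosed (coronaIn X) := by
  refine ⟨?_⟩
  rw [coronaIn, compl_compl, isOpen_iff_forall_mem_open]
  rintro _ ⟨x, rfl⟩
  obtain ⟨O, hO, hx, hOr, -⟩ := exists_isOpen_toHigson x
  exact ⟨O, hOr, hO, hx⟩

theorem isClosedEmbedding_coronaIncl [ProperSpace X] :
    IsClosedEmbedding (coronaIncl (X := X)) where
  toIsEmbedding := IsEmbedding.inclusion sdiff_subset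
  isClosed_range := by
    rw [range_coronaIncl]
    exact isClosed_coronaIn

/-- Points near infinity of `X` lie in any given neighborhood of the corona. -/
theorem eventually_toHigson_mem [ProperSpace X] {O : Set (higsonCompactification X)}
    (hO : IsOpen O) (hc : coronaIn X ⊆ O) : ∀ᶠ x in cobounded X, toHigson x ∈ O := by
  choose W hW hxW _ hWb using exists_isOpen_toHigson (X := X)
  obtain ⟨t, ht⟩ := hO.isClosed_compl.isCompact.elim_finite_subcover W hW fun p hp => by
    obtain ⟨x, rfl⟩ : p ∈ range toHigson := by
      by_contra hn
      exact hp (hc hn)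
    exact mem_iUnion.2 ⟨x, hxW x⟩
  have hb : IsBounded (⋃ x ∈ t, closedBall x (1 : ℝ)) :=
    (isBounded_biUnion_finset t).2 fun x _ => isBounded_closedBall
  filter_upwards [isBounded_def.1 hb] with x hx
  by_contra hn
  obtain ⟨y, hy, hxy⟩ := mem_iUnion₂.1 (ht hn)
  exact hx (mem_iUnion₂.2 ⟨y, hy, hWb y hxy⟩)

/-- The traces on `X` of the neighborhoods of a corona point reach arbitrarily far out. -/
theorem neBot_comap_toHigson [ProperSpace X] {p : higsonCompactification X}
    (hp : p ∈ coronaIn X) : (comap toHigson (𝓝 p) ⊓ cobounded X).NeBot := by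
  rw [inf_comm, inf_neBot_iff]
  intro s hs t ht
  obtain ⟨O, hO, hOt⟩ := ht
  rw [cobounded_eq_cocompact, mem_cocompact] at hs
  obtain ⟨K, hK, hKs⟩ := hs
  obtain ⟨_, ⟨x, rfl⟩, hzO, hzK⟩ := dense_range_toHigson.inter_nhds_nonempty (x := p)
    (inter_mem hO ((hK.image continuous_toHigson).isClosed.isOpen_compl.mem_nhds
      fun h => hp (image_subset_range _ _ h)))
  exact ⟨x, hKs fun hx => hzK (mem_image_of_mem _ hx), hOt hzO⟩

end Higson

/-! ### Maps into the cone versus maps into the base -/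

theorem AsympLipschitz.max {X : Type*} [MetricSpace X] {p q : X → ℝ} (hp : AsympLipschitz p)
    (hq : AsympLipschitz q) : AsympLipschitz fun x => max (p x) (q x) := by
  obtain ⟨a, ha, b, hb, h⟩ := hp.prodMk hq
  exact .of_le fun x y => (abs_max_sub_max_le_max _ _ _ _).trans (h x y)

theorem AsympLipschitz.min {X : Type*} [MetricSpace X] {p q : X → ℝ} (hp : AsympLipschitz p)
    (hq : AsympLipschitz q) : AsympLipschitz fun x => min (p x) (q x) := by
  obtain ⟨a, ha, b, hb, h⟩ := hp.prodMk hq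
  exact .of_le fun x y => (abs_min_sub_min_le_max _ _ _ _).trans (h x y)

theorem AsympLipschitz.sub {X : Type*} [MetricSpace X] {p q : X → ℝ} (hp : AsympLipschitz p)
    (hq : AsympLipschitz q) : AsympLipschitz fun x => p x - q x := by
  obtain ⟨a, ha, b, hb, h⟩ := hp
  obtain ⟨c, hc, d, hd, h'⟩ := hq
  refine .of_le (lam := a + c) (ε := b + d) fun x y => ?_
  have := h x y
  have := h' x y
  linarith [dist_sub_sub_le (p x) (q x) (p y) (q y)]

namespace TubularRetraction

variable {L : Type*} [MetricSpace L] {n : ℕ} (T : TubularRetraction L n)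
  {hd : ∀ x y : L, dist x y ≤ 1} {X : Type*} [MetricSpace X]

/-- Maps into the embedded copy of `L` are lifted to `L` by the retraction. -/
theorem exists_lift {Z : Type*} [TopologicalSpace Z] {w : Z → EuclideanSpace ℝ (Fin n)}
    (hw : Continuous w) (hwe : ∀ z, w z ∈ range T.e) :
    ∃ g : Z → L, Continuous g ∧ ∀ z, T.e (g z) = w z := by
  have htube : ∀ z, w z ∈ T.tube := fun z => self_subset_cthickening _ (hwe z)
  refine ⟨fun z => T.r (w z), T.continuousOn_r.comp_continuous hw htube, fun z => ?_⟩
  obtain ⟨x, hx⟩ := hwe z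
  simp only [← hx, T.r_e]

/-- The direction of an asymptotically Lipschitz map `G` into the cone, restricted to a part of
`X` on which the radius dominates a function `σ` going to infinity, extends to the Higson
compactification: divide the euclidean coordinates of `G` by `max ‖G‖ σ`, not by `‖G‖`. -/
theorem exists_higson_direction [CompactSpace L] [ProperSpace X] {G : X → OpenCone L hd}
    (hGc : Continuous G) (hGl : AsympLipschitz G) {σ : X → ℝ} (hσc : Continuous σ)
    (hσl : AsympLipschitz σ) (hσ0 : ∀ x, 0 < σ x)
    (ht : Tendsto (fun x => max (G x).radius (σ x)) (cobounded X) atTop) :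
    ∃ w : higsonCompactification X → EuclideanSpace ℝ (Fin n), Continuous w ∧
      ∀ x, σ x ≤ (G x).radius → w (toHigson x) = T.e (G x).direction := by
  obtain ⟨C, hC0, hC⟩ := T.exists_norm_e_le
  obtain ⟨K, hE⟩ := T.exists_lipschitzWith_coneE (hd := hd)
  have hq0 : ∀ x, 0 < max (G x).radius (σ x) := fun x => lt_max_of_lt_right (hσ0 x)
  have hrad : Continuous fun x => (G x).radius :=
    OpenCone.lipschitzWith_radius.continuous.comp hGc
  have hpq : ∀ x, ‖T.coneE (G x)‖ ≤ C * max (G x).radius (σ x) := fun x => by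
    rw [coneE, norm_smul, Real.norm_of_nonneg (G x).radius_nonneg, mul_comm]
    exact mul_le_mul (hC _) (le_max_left _ _) (G x).radius_nonneg hC0
  have hosc : SlowOsc fun x => (max (G x).radius (σ x))⁻¹ • T.coneE (G x) :=
    slowOsc_inv_smul (hE.comp_asympLipschitz hGl)
      ((OpenCone.lipschitzWith_radius.comp_asympLipschitz hGl).max hσl) hq0 hpq ht
  have hcont : Continuous fun x => (max (G x).radius (σ x))⁻¹ • T.coneE (G x) :=
    ((hrad.max hσc).inv₀ fun x => (hq0 x).ne').smul (hE.continuous.comp hGc)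
  obtain ⟨w, hwc, hw⟩ := hosc.exists_extension_higson hcont (C := C) fun x => by
    rw [norm_smul, norm_inv, Real.norm_of_nonneg (hq0 x).le, inv_mul_le_iff₀ (hq0 x), mul_comm]
    exact hpq x
  refine ⟨w, hwc, fun x hx => ?_⟩
  rw [hw, max_eq_left hx, coneE, inv_smul_smul₀ ((hσ0 x).trans_le hx).ne']

/-- The angular part of the cone distance for a slowly scaled slowly oscillating direction. -/
theorem min_mul_dist_r_le (hd : ∀ x y : L, dist x y ≤ 1) {u : X → EuclideanSpace ℝ (Fin n)}
    {τ : X → ℝ} (hτ0 : ∀ x, 0 ≤ τ x)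
    (hτ : ∀ x y, dist y x < τ x → τ x * dist (u y) (u x) ≤ 1) {x y : X} (hx : u x ∈ T.tube)
    (hy : u y ∈ T.tube) :
    min (τ x) (τ y) * dist (T.r (u x)) (T.r (u y)) ≤ dist x y + T.Kr := by
  have hK : (0 : ℝ) ≤ T.Kr := T.Kr.2
  refine (mul_le_mul_of_nonneg_right (min_le_left _ _) dist_nonneg).trans ?_
  rcases lt_or_ge (dist y x) (τ x) with h | h
  · have h1 := hτ x y h
    have h2 := mul_le_mul_of_nonneg_left (T.dist_r_le hx hy) (hτ0 x)
    rw [dist_comm (u y)] at h1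
    have h3 : τ x * (T.Kr * dist (u x) (u y)) ≤ T.Kr := by
      calc _ = T.Kr * (τ x * dist (u x) (u y)) := by ring
        _ ≤ T.Kr * 1 := mul_le_mul_of_nonneg_left h1 hK
        _ = T.Kr := mul_one _
    linarith [dist_nonneg (x := x) (y := y)]
  · have h1 := mul_le_mul_of_nonneg_left (hd (T.r (u x)) (T.r (u y))) (hτ0 x)
    rw [dist_comm] at h
    linarith

/-! ### From the asymptotic dimension of the space to the dimension of the corona -/

/-- A map from a closed part `C` of the corona is spread over the trace `A` on `X` of a
neighborhood of `C`, turned into a map `A → 𝒪L` by a slowly growing radius, extended to `X`, and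
read off at infinity. -/
theorem extDimLE_higsonCorona (T : TubularRetraction L n) [CompactSpace L] [ProperSpace X]
    (hX : AsympTau X (OpenCone L hd)) :
    ExtDimLE (higsonCorona X) L := by
  intro C hC f hf
  have hj : IsClosedEmbedding fun c : C => coronaIncl c.1 :=
    isClosedEmbedding_coronaIncl.comp hC.isClosedEmbedding_subtypeVal
  obtain ⟨u, hu⟩ := ContinuousMap.exists_extension hj
    (⟨_, T.lipschitz_e.continuous.comp hf⟩ : C(C, EuclideanSpace ℝ (Fin n)))
  replace hu : ∀ c : C, u (coronaIncl c.1) = T.e (f c) := fun c => DFunLike.congr_fun hu c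
  set A : Set X := {x | u (toHigson x) ∈ T.tube}
  have huh : Continuous fun x : X => u (toHigson x) := u.continuous.comp continuous_toHigson
  have hAc : IsClosed A := T.isClosed_tube.preimage huh
  obtain ⟨τ, hτl, hτ0, hτt, -, hτ⟩ := (slowOsc_comp_toHigson u.continuous).exists_slow
    (A := ∅) (ρ := fun _ : X => 0) (fun _ => Eventually.of_forall fun _ h => h.elim)
  let F : A → OpenCone L hd := fun a => OpenCone.point hd (T.r (u (toHigson a.1))) (τ a)
  have hFc : Continuous F := OpenCone.continuous_point.comp
    ((T.continuousOn_r.comp_continuous (huh.comp continuous_subtype_val) fun a => a.2).prodMk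
      (hτl.continuous.comp continuous_subtype_val))
  have hFr : Tendsto (fun a => (F a).radius) (cocompact A) atTop := by
    rw [cobounded_eq_cocompact] at hτt
    refine (hτt.comp hAc.isClosedEmbedding_subtypeVal.tendsto_cocompact).congr fun a => ?_
    exact (OpenCone.radius_point _ (hτ0 _)).symm
  have hF : IsAsympMorphism F := by
    refine ⟨hFc, fun K hK => isCompact_preimage_of_tendsto_radius hFc hFr hK,
      .of_le (lam := 2) (ε := T.Kr) fun a b => ?_⟩
    rw [OpenCone.dist_point_point_of_nonneg _ _ (hτ0 _) (hτ0 _)]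
    have h1 : |τ a - τ b| ≤ dist a b := by
      simpa [Real.dist_eq, Subtype.dist_eq] using hτl.dist_le_mul a.1 b.1
    have h2 := T.min_mul_dist_r_le hd hτ0 hτ a.2 b.2
    rw [← Subtype.dist_eq] at h2
    linarith
  obtain ⟨g, hg, hgF⟩ := hX A hAc F hF
  have hgt : Tendsto (fun x => (g x).radius) (cobounded X) atTop := by
    refine Filter.tendsto_atTop.2 fun M => ?_
    have hK := hg.isCompact_preimage _ (OpenCone.isCompact_radius_le M)
    filter_upwards [isBounded_def.1 hK.isBounded] with x hx
    exact (not_le.1 fun h => hx h).le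
  obtain ⟨w, hwc, hw⟩ := T.exists_higson_direction hg.continuous hg.asympLipschitz
    (σ := fun _ => 1) continuous_const (.of_le (lam := 0) (ε := 0) (by simp))
    (fun _ => one_pos) (tendsto_atTop_mono (fun x => le_max_left _ _) hgt)
  have hnb : ∀ p : higsonCorona X, (comap toHigson (𝓝 (coronaIncl p)) ⊓ cobounded X).NeBot :=
    fun p => neBot_comap_toHigson (coe_mem_higsonCorona_iff.1 p.2)
  have hlim : ∀ (p : higsonCorona X) {v : higsonCompactification X → EuclideanSpace ℝ (Fin n)},
      ContinuousAt v (coronaIncl p) → Tendsto (fun x => v (toHigson x))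
        (comap toHigson (𝓝 (coronaIncl p)) ⊓ cobounded X) (𝓝 (v (coronaIncl p))) :=
    fun p v hv => hv.tendsto.comp (tendsto_comap.mono_left inf_le_left)
  have hfar : ∀ᶠ x in cobounded X, w (toHigson x) = T.e (g x).direction := by
    filter_upwards [hgt.eventually_ge_atTop 1] with x hx using hw x hx
  have hwr : ∀ p : higsonCorona X, w (coronaIncl p) ∈ range T.e := fun p => by
    have := hnb p
    refine T.isClosedEmbedding_e.isClosed_range.mem_of_tendsto (hlim p hwc.continuousAt) ?_
    filter_upwards [hfar.filter_mono inf_le_right] with x hx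
    exact hx ▸ mem_range_self _
  obtain ⟨ĝ, hĝc, hĝ⟩ := T.exists_lift (hwc.comp isClosedEmbedding_coronaIncl.continuous) hwr
  refine ⟨ĝ, hĝc, fun c => T.isClosedEmbedding_e.injective ?_⟩
  -- along points of `X` tending to `c`, the map `w` agrees with `e ∘ r ∘ u`
  have := hnb c
  have hv : ContinuousAt (fun p => T.e (T.r (u p))) (coronaIncl c.1) := by
    refine T.lipschitz_e.continuous.continuousAt.comp (ContinuousAt.comp ?_
      u.continuous.continuousAt)
    rw [hu]
    exact T.continuousOn_r.continuousAt (T.tube_mem_nhds _)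
  have h2 := hlim c hv
  simp only [hu, T.r_e] at h2
  refine (hĝ c).trans (tendsto_nhds_unique_of_eventuallyEq (hlim c hwc.continuousAt) h2 ?_)
  have hnear : ∀ᶠ x in comap toHigson (𝓝 (coronaIncl c.1)), x ∈ A := by
    have hmem : ∀ᶠ p in 𝓝 (coronaIncl c.1), u p ∈ T.tube :=
      u.continuous.continuousAt.eventually_mem (by rw [hu]; exact T.tube_mem_nhds _)
    exact tendsto_comap.eventually hmem
  filter_upwards [hnear.filter_mono inf_le_left, hfar.filter_mono inf_le_right,
    (hτt.eventually_gt_atTop 0).filter_mono inf_le_right] with x hxA hx hxτ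
  rw [hx, hgF ⟨x, hxA⟩, OpenCone.direction_point _ hxτ]

end TubularRetraction

/-! ### From the dimension of the corona to the asymptotic dimension of the space -/

/-- Tietze's theorem for two maps on closed sets that agree on the overlap. -/
theorem exists_continuous_eqOn_of_isClosed.{u, v} {Z : Type u} {V : Type v} [TopologicalSpace Z]
    [NormalSpace Z] [TopologicalSpace V] [TietzeExtension.{u} V] {P Q : Set Z} (hP : IsClosed P) (hQ : IsClosed Q)
    {w v : Z → V} (hw : ContinuousOn w P) (hv : ContinuousOn v Q) (h : EqOn w v (P ∩ Q)) :
    ∃ u : Z → V, Continuous u ∧ EqOn u w P ∧ EqOn u v Q := by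
  classical
  have h1 : EqOn (P.piecewise w v) w P := P.piecewise_eqOn w v
  have h2 : EqOn (P.piecewise w v) v Q := fun z hz => by
    by_cases hzP : z ∈ P
    · rw [h1 hzP, h ⟨hzP, hz⟩]
    · exact P.piecewise_eq_of_notMem w v hzP
  have hc : ContinuousOn (P.piecewise w v) (P ∪ Q) :=
    (hw.congr h1).union_of_isClosed (hv.congr h2) hP hQ
  obtain ⟨u, hu⟩ := ContinuousMap.exists_restrict_eq (hP.union hQ)
    ⟨_, continuousOn_iff_continuous_domRestrict.1 hc⟩
  have hu' : EqOn u (P.piecewise w v) (P ∪ Q) := fun z hz => DFunLike.congr_fun hu ⟨z, hz⟩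
  exact ⟨u, u.continuous, fun z hz => (hu' (Or.inl hz)).trans (h1 hz),
    fun z hz => (hu' (Or.inr hz)).trans (h2 hz)⟩

theorem min_max_max_le {a b a' b' : ℝ} (hb : 0 ≤ b) (ha' : 0 ≤ a') (hb' : 0 ≤ b') :
    min (max a a') (max b b') ≤ min a b + min a' b' + |a - b| := by
  have h1 := neg_abs_le (a - b)
  have h2 := le_abs_self (a - b)
  rcases le_total a a' with h | h <;> rcases le_total b b' with h' | h' <;>
    rcases le_total a b with h'' | h'' <;> rcases le_total a' b' with h''' | h''' <;>
    simp only [max_eq_left, max_eq_right, min_eq_left, min_eq_right, h, h', h'', h'''] <;>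
    first
      | linarith [min_le_left a' b, min_le_right a' b]
      | linarith [min_le_left a b', min_le_right a b']

namespace TubularRetraction

variable {L : Type*} [MetricSpace L] {n : ℕ} (T : TubularRetraction L n)
  {hd : ∀ x y : L, dist x y ≤ 1} {X : Type*} [MetricSpace X]

/-- To extend a proper map `A → 𝒪L` it suffices to extend it near infinity: over the remaining
bounded piece of `X` the extension without properness suffices. -/
theorem exists_extension_of_cobounded (T : TubularRetraction L n) [CompactSpace L] [Nonempty L]
    [ProperSpace X] {A Y : Set X} (hA : IsClosed A) {G g : X → OpenCone L hd}
    (hG : Continuous G) (hGl : AsympLipschitz G) (hY : Y ∈ cobounded X) (hgc : ContinuousOn g Y)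
    {lam ε : ℝ} (hgl : ∀ x ∈ Y, ∀ y ∈ Y, dist (g x) (g y) ≤ lam * dist x y + ε)
    (hgt : Tendsto (fun x => (g x).radius) (cobounded X) atTop) (hgG : ∀ x ∈ Y ∩ A, g x = G x) :
    ∃ H : X → OpenCone L hd, IsAsympMorphism H ∧ EqOn H G A := by
  classical
  obtain ⟨K, hK, hKY⟩ : ∃ K, IsCompact K ∧ Kᶜ ⊆ Y := by
    rwa [cobounded_eq_cocompact, mem_cocompact] at hY
  -- a closed set inside `Y` with bounded complement
  set Z : Set X := (thickening 1 K)ᶜ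
  have hZc : IsClosed Z := isOpen_thickening.isClosed_compl
  have hZY : Z ⊆ Y := (compl_subset_compl.2 (self_subset_thickening one_pos K)).trans hKY
  have hKb : IsBounded (thickening 1 K) := hK.isBounded.thickening
  have hFA : EqOn (A.piecewise G g) G A := A.piecewise_eqOn G g
  have hFZ : EqOn (A.piecewise G g) g Z := fun x hx => by
    by_cases hxA : x ∈ A
    · rw [hFA hxA, hgG x ⟨hZY hx, hxA⟩]
    · exact A.piecewise_eq_of_notMem G g hxA
  have hFc : ContinuousOn (A.piecewise G g) (A ∪ Z) :=
    (hG.continuousOn.congr hFA).union_of_isClosed ((hgc.mono hZY).congr hFZ) hA hZc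
  have hB : IsBounded (thickening 1 K ∩ A) := hKb.subset inter_subset_left
  have hFB : IsBounded (A.piecewise G g '' (thickening 1 K ∩ A)) := by
    obtain ⟨a, ha, b, hb, hab⟩ := hGl
    obtain ⟨D, hD⟩ := isBounded_iff.1 hB
    refine isBounded_iff.2 ⟨a * D + b, ?_⟩
    rintro _ ⟨x, hx, rfl⟩ _ ⟨y, hy, rfl⟩
    rw [hFA hx.2, hFA hy.2]
    have := mul_le_mul_of_nonneg_left (hD hx hy) ha.le
    linarith [hab x y]
  obtain ⟨lam', ε', hF⟩ := exists_asympLipschitz_bound_union (F := A.piecewise G g)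
    (fun x hx y hy => by rw [hFZ hx, hFZ hy]; exact hgl x (hZY hx) y (hZY hy)) hB hFB
  have hsub : ∀ x ∈ A ∪ Z, x ∈ (thickening 1 K ∩ A) ∪ Z := by
    rintro x (hx | hx)
    · by_cases hxK : x ∈ thickening 1 K
      · exact Or.inl ⟨hxK, hx⟩
      · exact Or.inr hxK
    · exact Or.inr hx
  obtain ⟨H, hHc, hHl, hH⟩ := T.exists_extension_openCone (hA.union hZc)
    (f := (A ∪ Z).domRestrict (A.piecewise G g)) (continuousOn_iff_continuous_domRestrict.1 hFc)
    (.of_le fun x y => hF x (hsub x x.2) y (hsub y y.2))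
  have hHr : Tendsto (fun x => (H x).radius) (cocompact X) atTop := by
    rw [← cobounded_eq_cocompact]
    refine hgt.congr' ?_
    filter_upwards [isBounded_def.1 hKb] with x hx
    have : H x = g x := (hH ⟨x, Or.inr hx⟩).trans (hFZ hx)
    rw [this]
  exact ⟨H, ⟨hHc, fun _ hQ => isCompact_preimage_of_tendsto_radius hHc hHr hQ, hHl⟩,
    fun x hx => (hH ⟨x, Or.inl hx⟩).trans (hFA hx)⟩

/-- Let `G` extend `f` without properness and let `N` be the region in which the radius of `G`
dominates a slowly growing function `σ`. The direction of `G` on `N` extends to the Higson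
compactification, and by hypothesis its values on the corona extend to the corona within `L`, hence
to a map `u` on the compactification with values in the tube near the corona. Near infinity
the extension has direction `r ∘ u`. Its radius is `‖G‖` well inside `N` and grows slowly elsewhere. -/
theorem asympTau_openCone (T : TubularRetraction L n) [CompactSpace L] [Nonempty L]
    [ProperSpace X] (hX : ExtDimLE (higsonCorona X) L) : AsympTau X (OpenCone L hd) := by
  intro A hA f hf
  obtain ⟨G, hGc, hGl, hGf⟩ := T.exists_extension_openCone hA hf.continuous hf.asympLipschitz
  suffices h : ∃ H : X → OpenCone L hd, IsAsympMorphism H ∧ EqOn H G A by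
    obtain ⟨H, hH, hHG⟩ := h
    exact ⟨H, hH, fun a => (hHG a.2).trans (hGf a)⟩
  have hrc : Continuous fun x => (G x).radius :=
    OpenCone.lipschitzWith_radius.continuous.comp hGc
  have hrl : AsympLipschitz fun x => (G x).radius :=
    OpenCone.lipschitzWith_radius.comp_asympLipschitz hGl
  have hGA : ∀ M, ∀ᶠ x in cobounded X, x ∈ A → M ≤ (G x).radius := fun M => by
    filter_upwards [hf.eventually_le_radius M] with x hx h
    rw [hGf ⟨x, h⟩]
    exact hx h
  -- a function `τ + 1` tending to infinity with `2 * (τ + 1) ≤ ‖G‖` on `A`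
  obtain ⟨τ, hτl, hτ0, hτt, hτA, -⟩ := (slowOsc_comp_toHigson (X := X)
    (continuous_const (y := (0 : ℝ)))).exists_slow (A := A) (ρ := fun x => (G x).radius / 2 - 1)
    fun M => by
      filter_upwards [hGA (2 * (M + 1))] with x hx h
      linarith [hx h]
  have hσl : LipschitzWith 1 fun x => τ x + 1 := by
    refine LipschitzWith.of_dist_le_mul fun x y => ?_
    simpa using hτl.dist_le_mul x y
  have hσ0 : ∀ x, 0 < τ x + 1 := fun x => by linarith [hτ0 x]
  obtain ⟨w, hwc, hw⟩ := T.exists_higson_direction hGc hGl hσl.continuous hσl.asympLipschitz hσ0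
    (tendsto_atTop_mono (fun x => le_max_right _ _) (tendsto_atTop_add_const_right _ 1 hτt))
  set N : Set X := {x | τ x + 1 ≤ (G x).radius}
  set P : Set (higsonCompactification X) := closure (toHigson '' N)
  have hwP : ∀ p ∈ P, w p ∈ range T.e := by
    refine closure_minimal ?_ (T.isClosedEmbedding_e.isClosed_range.preimage hwc)
    rintro _ ⟨x, hx, rfl⟩
    exact ⟨_, (hw x hx).symm⟩
  -- extend the limit directions over the corona
  obtain ⟨φ, hφc, hφ⟩ := T.exists_lift
    (Z := (coronaIncl ⁻¹' P : Set (higsonCorona X))) (w := fun p => w (coronaIncl p.1))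
    (hwc.comp (isClosedEmbedding_coronaIncl.continuous.comp continuous_subtype_val))
    fun p => hwP _ p.2
  obtain ⟨ψ, hψc, hψ⟩ := hX _ (isClosed_closure.preimage isClosedEmbedding_coronaIncl.continuous)
    φ hφc
  obtain ⟨v, hv⟩ := ContinuousMap.exists_extension isClosedEmbedding_coronaIncl
    (⟨_, T.lipschitz_e.continuous.comp hψc⟩ : C(higsonCorona X, EuclideanSpace ℝ (Fin n)))
  replace hv : ∀ p, v (coronaIncl p) = T.e (ψ p) := fun p => DFunLike.congr_fun hv p
  obtain ⟨u, huc, huw, huv⟩ := exists_continuous_eqOn_of_isClosed (P := P) (Q := coronaIn X)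
    isClosed_closure isClosed_coronaIn hwc.continuousOn v.continuous.continuousOn (by
      rintro p ⟨hpP, hpQ⟩
      rw [← range_coronaIncl] at hpQ
      obtain ⟨q, rfl⟩ := hpQ
      rw [hv, hψ ⟨q, hpP⟩, hφ])
  have huN : ∀ x ∈ N, u (toHigson x) = T.e (G x).direction := fun x hx =>
    (huw (subset_closure (mem_image_of_mem _ hx))).trans (hw x hx)
  have htube : ∀ᶠ x in cobounded X, u (toHigson x) ∈ T.tube := by
    refine (eventually_toHigson_mem (O := u ⁻¹' thickening T.η (range T.e))
      (isOpen_thickening.preimage huc) fun p hp => ?_).mono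
      fun x hx => thickening_subset_cthickening _ _ hx
    have hup := huv hp
    rw [← range_coronaIncl] at hp
    obtain ⟨q, rfl⟩ := hp
    rw [mem_preimage, hup, hv]
    exact self_subset_thickening T.η_pos _ (mem_range_self _)
  obtain ⟨τ', hτ'l, hτ'0, hτ't, hτ'A, hτ'u⟩ := (slowOsc_comp_toHigson huc).exists_slow hGA
  -- equal to `‖G‖` where `2 * (τ + 1) ≤ ‖G‖`, and zero outside `N`
  set κ : X → ℝ := fun x =>
    min (G x).radius (max 0 (((G x).radius - (τ x + 1)) - ((τ x + 1) - (G x).radius)))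
  have hκ0 : ∀ x, 0 ≤ κ x := fun x => le_min (G x).radius_nonneg (le_max_left _ _)
  have hκN : ∀ x, 0 < κ x → x ∈ N := fun x hx => by
    rcases lt_max_iff.1 (hx.trans_le (min_le_right _ _)) with h | h
    · exact absurd h (lt_irrefl _)
    · change τ x + 1 ≤ (G x).radius
      linarith
  have hκc : Continuous κ := hrc.min (continuous_const.max
    ((hrc.sub hσl.continuous).sub (hσl.continuous.sub hrc)))
  have hκl : AsympLipschitz κ :=
    hrl.min ((AsympLipschitz.of_le (lam := 0) (ε := 0) (by simp)).max
      ((hrl.sub hσl.asympLipschitz).sub (hσl.asympLipschitz.sub hrl)))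
  have hR0 : ∀ x, 0 ≤ max (τ' x) (κ x) := fun x => (hτ'0 x).trans (le_max_left _ _)
  obtain ⟨a, ha, b, hb, hRl⟩ := hτ'l.asympLipschitz.max hκl
  obtain ⟨c, hc, d, hd', hGl'⟩ := id hGl
  set Y : Set X := {x | u (toHigson x) ∈ T.tube ∧ 0 < τ x ∧ 0 < τ' x}
  refine T.exists_extension_of_cobounded hA hGc hGl (Y := Y)
    (g := fun x => OpenCone.point hd (T.r (u (toHigson x))) (max (τ' x) (κ x)))
    (lam := a + (1 + c + 1)) (ε := b + (T.Kr + d)) ?_ ?_ ?_ ?_ ?_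
  · filter_upwards [htube, hτt.eventually_gt_atTop 0, hτ't.eventually_gt_atTop 0]
      with x h1 h2 h3 using ⟨h1, h2, h3⟩
  · exact OpenCone.continuous_point.comp_continuousOn
      ((T.continuousOn_r.comp (huc.comp continuous_toHigson).continuousOn fun x hx => hx.1).prodMk
        (hτ'l.continuous.max hκc).continuousOn)
  · intro x hx y hy
    rw [OpenCone.dist_point_point_of_nonneg _ _ (hR0 x) (hR0 y)]
    set D := dist (T.r (u (toHigson x))) (T.r (u (toHigson y))) with hD
    have hD0 : 0 ≤ D := dist_nonneg
    have h1 : |max (τ' x) (κ x) - max (τ' y) (κ y)| ≤ a * dist x y + b := hRl x y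
    have h2 : min (τ' x) (τ' y) * D ≤ dist x y + T.Kr :=
      T.min_mul_dist_r_le hd (u := fun x => u (toHigson x)) hτ'0 hτ'u hx.1 hy.1
    have h3 : min (κ x) (κ y) * D ≤ c * dist x y + d := by
      rcases (le_min (hκ0 x) (hκ0 y)).eq_or_lt with h | h
      · rw [← h, zero_mul]
        positivity
      · have hDG : D = dist (G x).direction (G y).direction := by
          rw [hD, huN x (hκN x (h.trans_le (min_le_left _ _))),
            huN y (hκN y (h.trans_le (min_le_right _ _))), T.r_e, T.r_e]
        rw [hDG]
        exact (mul_le_mul_of_nonneg_right (min_le_min (min_le_left _ _) (min_le_left _ _))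
          dist_nonneg).trans ((OpenCone.min_radius_mul_dist_direction_le _ _).trans (hGl' x y))
    have h4 : |τ' x - τ' y| * D ≤ dist x y := by
      have : |τ' x - τ' y| ≤ dist x y := by simpa [Real.dist_eq] using hτ'l.dist_le_mul x y
      calc _ ≤ dist x y * 1 := mul_le_mul this (hd _ _) hD0 dist_nonneg
        _ = _ := mul_one _
    have h5 := mul_le_mul_of_nonneg_right
      (min_max_max_le (a := τ' x) (hτ'0 y) (hκ0 x) (hκ0 y)) hD0
    rw [add_mul, add_mul] at h5
    linarith
  · refine tendsto_atTop_mono (fun x => ?_) hτ't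
    rw [OpenCone.radius_point _ (hR0 x)]
    exact le_max_left _ _
  · rintro x ⟨⟨-, hx1, hx2⟩, hxA⟩
    have h1 := hτA x hxA hx1
    have h2 := hτ'A x hxA hx2
    have h3 : κ x = (G x).radius :=
      min_eq_left (le_max_of_le_right (by linarith))
    have h4 : x ∈ N := by
      change τ x + 1 ≤ (G x).radius
      linarith
    simp only [h3, max_eq_right h2, huN x h4, T.r_e]
    exact OpenCone.point_direction_radius _

end TubularRetraction

theorem theorem4p1 (L : Type*) [MetricSpace L] [CompactSpace L] [Nonempty L]
    (hdiam : ∀ x y : L, dist x y ≤ 1) (hL : IsALNER L)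
    (X : Type*) [MetricSpace X] [ProperSpace X] :
    AsympTau X (OpenCone L hdiam) ↔ ExtDimLE (higsonCorona X) L := by
  obtain ⟨n, ⟨T⟩⟩ := hL.exists_tubularRetraction
  exact ⟨T.extDimLE_higsonCorona, T.asympTau_openCone⟩
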